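/- Let $d\in\mathbb N$ and let $\mu_{1,d}$ be the standard Gaussian measure on $\mathbb R^{2d}$, whose points are written $(a,b)$ with $a,b\in\mathbb R^d$; let $(\cdot,\cdot)$ be the standard scalar product of $\mathbb R^{2d}$, extended bilinearly to $\mathbb C^{2d}$. For $\varphi\in L^2(\mu_{1,d})$ with chaos decomposition $\varphi=\sum_{n\ge 0}\langle :x^{\otimes n}:,\varphi^{(n)}\rangle$, $\varphi^{(n)}\in(\mathbb C^{2d})^{\hat\otimes n}$, put $$\|\varphi\|_q^2=\sum_{n=0}^\infty n!\,2^{qn}\,|\varphi^{(n)}|^2,\qquad q\in\mathbb N_0 .$$ The space $(\mathcal M)$ of Hida test functions consists of all $\varphi\in L^2(\mu_{1,d})$ with $\|\varphi\|_q<\infty$ for every $q$, with the locally convex topology generated by the norms $\|\cdot\|_q$. The space $(\mathcal M)'$ of Hida distributions is its topological dual with the strong topology (uniform convergence on bounded subsets of $(\mathcal M)$), and $\langle\!\langle\cdot,\cdot\rangle\!\rangle$ is the bilinear dual pairing. The $T$-transform of $\Phi\in(\mathcal M)'$ is $$T\Phi(f,g)=\Big\langle\!\!\Big\langle\Phi,\exp\big(i((\cdot),(f,g))\big)\Big\rangle\!\!\Big\rangle,\qquad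 (f,g)\in\mathbb R^{2d}.$$ For $\epsilon>0$ let $$\Phi_{1,d,\epsilon}(a,b)=(2\pi)^d\exp\Big(-\tfrac12\big((a,b),K_\epsilon(a,b)\big)\Big),\qquad K_\epsilon=-\left((1-\epsilon)\,\mathrm{Id}_{\mathbb R^{2d}}+i\begin{pmatrix}0&\mathrm{Id}_{\mathbb R^d}\\ \mathrm{Id}_{\mathbb R^d}&0\end{pmatrix}\right).$$ Then for every $\epsilon>0$ and every $\varphi\in(\mathcal M)$ the function $\Phi_{1,d,\epsilon}\,\varphi$ is $\mu_{1,d}$-integrable, and $\Phi_{1,d,\epsilon}$ is a Hida distribution through $\langle\!\langle\Phi_{1,d,\epsilon},\varphi\rangle\!\rangle=\int_{\mathbb R^{2d}}\Phi_{1,d,\epsilon}\,\varphi\,d\mu_{1,d}$. Moreover there exists a Hida distribution $\Phi_{1,d}\in(\mathcal M)'$ such that $$\lim_{\epsilon\downarrow 0}\Phi_{1,d,\epsilon}=\Phi_{1,d}$$ in the strong topology of $(\mathcal M)'$. For every $(f,g)\in\mathbb R^{2d}$ the function $\exp(i((\cdot),(f,g)))$ belongs to $(\mathcal M)$, and the $T$-transform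 of $\Phi_{1,d}$ is $$T\Phi_{1,d}(f,g)=(2\pi)^d\exp\Big(-i\sum_{\mu=1}^d f_\mu g_\mu\Big),\qquad (f,g)\in\mathbb R^{2d}.$$ -/

import Mathlib

open MeasureTheory ProbabilityTheory Filter Topology
open scoped ENNReal Matrix

noncomputable section

namespace SymplecticFeynman

/-- Index set of the `2d` real coordinates: `Sum.inl` labels the components of `a` (or `f`),
`Sum.inr` those of `b` (or `g`). -/
abbrev Idx (d : ℕ) : Type := Fin d ⊕ Fin d

/-- The real vector space `ℝ^{2d}` of pairs `(a, b)`, `a, b ∈ ℝ^d`; the pair `(a, b)` is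
`Sum.elim a b`. The standard scalar product is `x ⬝ᵥ y`. -/
abbrev Vec (d : ℕ) : Type := Idx d → ℝ

/-- The standard Gaussian measure `μ_{1,d}` on `ℝ^{2d}`. -/
def gaussian (d : ℕ) : Measure (Vec d) := Measure.pi fun _ => gaussianReal 0 1

instance (d : ℕ) : IsProbabilityMeasure (gaussian d) := by
  unfold gaussian; infer_instance

/-- The complex Hilbert space `L²(μ_{1,d})`. -/
abbrev L2 (d : ℕ) : Type := Lp ℂ 2 (gaussian d)

/-- Degree `|α|` of a multi-index. -/
def degree {d : ℕ} (α : Idx d → ℕ) : ℕ := ∑ i, α i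

/-- The normalized Hermite function `h_α(x) = ∏ i, He_{α i}(x i) / √((α i)!)`, with `He_n` the
probabilists' Hermite polynomials. The `h_α` with `|α| = n` are the normalized Wick monomials of
order `n` in the coordinates. -/
def hermiteFun {d : ℕ} (α : Idx d → ℕ) (x : Vec d) : ℂ :=
  ∏ i, (((Polynomial.aeval (x i) (Polynomial.hermite (α i)) / √((α i).factorial : ℝ) : ℝ)) : ℂ)

lemma memLp_pow (n : ℕ) (p : ℝ≥0∞) (hp : p ≠ ∞) :
    MemLp (fun x : ℝ => x ^ n) p (gaussianReal 0 1) := by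
  rcases Nat.eq_zero_or_pos n with rfl | hn
  · simpa using memLp_const (1 : ℝ)
  · have h := (memLp_id_gaussianReal' (μ := 0) (v := 1) (p * n)
      (ENNReal.mul_ne_top hp (by simp))).norm_rpow_div (q := (n : ℝ≥0∞))
    have hn' : (n : ℝ≥0∞) ≠ 0 := by exact_mod_cast hn.ne'
    rw [ENNReal.mul_div_cancel_right hn' (by simp)] at h
    refine h.of_le (by fun_prop) (Eventually.of_forall fun x => ?_)
    simp

lemma memLp_hermite (n : ℕ) (c : ℝ) :
    MemLp (fun x : ℝ => (((Polynomial.aeval x (Polynomial.hermite n) / c : ℝ)) : ℂ)) 2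
      (gaussianReal 0 1) := by
  have he : (fun x : ℝ => Polynomial.aeval x (Polynomial.hermite n) / c) = fun x : ℝ =>
      ∑ i ∈ Finset.range ((Polynomial.hermite n).natDegree + 1),
        (Polynomial.hermite n).coeff i • x ^ i / c := by
    funext x
    rw [Polynomial.aeval_eq_sum_range, Finset.sum_div]
  suffices h : MemLp (fun x : ℝ => Polynomial.aeval x (Polynomial.hermite n) / c) 2
      (gaussianReal 0 1) from h.ofReal
  rw [he]
  refine memLp_finsetSum _ fun i _ => ?_
  have h := (memLp_pow i 2 (by simp)).const_mul (((Polynomial.hermite n).coeff i : ℝ) / c)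
  refine h.congr_norm (by fun_prop) (Eventually.of_forall fun x => ?_)
  congr 1
  rw [zsmul_eq_mul]
  ring

lemma memLp_hermiteFun {d : ℕ} (α : Idx d → ℕ) : MemLp (hermiteFun α) 2 (gaussian d) := by
  have hm : AEStronglyMeasurable (hermiteFun α) (gaussian d) := by
    have : Continuous (hermiteFun α) := by
      unfold hermiteFun
      refine continuous_finsetProd _ fun i _ => Complex.continuous_ofReal.comp ?_
      exact ((Polynomial.continuous_aeval _).comp (continuous_apply i)).div_const _
    exact this.aestronglyMeasurable
  rw [memLp_two_iff_integrable_sq_norm hm]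
  have h : ∀ x, ‖hermiteFun α x‖ ^ 2 = ∏ i, ‖(((Polynomial.aeval (x i)
      (Polynomial.hermite (α i)) / √((α i).factorial : ℝ) : ℝ)) : ℂ)‖ ^ 2 := by
    intro x
    rw [hermiteFun, norm_prod, Finset.prod_pow]
  simp_rw [h]
  exact Integrable.fintype_prod
    (f := fun i (t : ℝ) => ‖(((Polynomial.aeval t
      (Polynomial.hermite (α i)) / √((α i).factorial : ℝ) : ℝ)) : ℂ)‖ ^ 2)
    fun i => (memLp_two_iff_integrable_sq_norm (memLp_hermite _ _).1).1 (memLp_hermite _ _)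

/-- `h_α` as an element of `L²(μ_{1,d})`. -/
def hermiteLp {d : ℕ} (α : Idx d → ℕ) : L2 d := (memLp_hermiteFun α).toLp (hermiteFun α)

/-- The coefficient `⟨h_α, φ⟩` of `φ ∈ L²(μ_{1,d})` in its chaos decomposition. The kernel
`φ^{(n)} ∈ (ℂ^{2d})^{⊗̂ n}` of the `n`-th chaos satisfies `n! |φ^{(n)}|² = ∑_{|α|=n} |⟨h_α, φ⟩|²`. -/
def chaosCoeff {d : ℕ} (α : Idx d → ℕ) (φ : L2 d) : ℂ := inner ℂ (hermiteLp α) φ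

/-- The space `(M)` of Hida test functions, as a subspace of `L²(μ_{1,d})`: all `φ` such that
`∑ₙ n! 2^{qn} |φ^{(n)}|² < ∞` for every `q`. -/
def hidaSubmodule (d : ℕ) : Submodule ℂ (L2 d) where
  carrier := {φ | ∀ q : ℕ, Summable fun α : Idx d → ℕ =>
    (2 : ℝ) ^ (q * degree α) * ‖chaosCoeff α φ‖ ^ 2}
  zero_mem' := fun q => by simp [chaosCoeff]
  add_mem' := by
    intro φ ψ hφ hψ q
    refine Summable.of_nonneg_of_le (fun α => by positivity) (fun α => ?_)
      (((hφ q).add (hψ q)).mul_left 2)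
    have h1 : ‖chaosCoeff α (φ + ψ)‖ ≤ ‖chaosCoeff α φ‖ + ‖chaosCoeff α ψ‖ := by
      simpa only [chaosCoeff, inner_add_right] using norm_add_le _ _
    have h2 : ‖chaosCoeff α (φ + ψ)‖ ^ 2 ≤ 2 * (‖chaosCoeff α φ‖ ^ 2 + ‖chaosCoeff α ψ‖ ^ 2) := by
      nlinarith [norm_nonneg (chaosCoeff α (φ + ψ)),
        sq_nonneg (‖chaosCoeff α φ‖ - ‖chaosCoeff α ψ‖)]
    have h3 : (0 : ℝ) ≤ 2 ^ (q * degree α) := by positivity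
    nlinarith [mul_le_mul_of_nonneg_left h2 h3]
  smul_mem' := by
    intro c φ hφ q
    refine ((hφ q).mul_left (‖c‖ ^ 2)).congr fun α => ?_
    simp only [chaosCoeff, inner_smul_right, norm_mul]
    ring

/-- The space `(M)` of Hida test functions, as a type of its own: it carries the projective
limit topology defined below and not the one of `L²(μ_{1,d})`. -/
def HidaTest (d : ℕ) : Type := hidaSubmodule d

instance (d : ℕ) : AddCommGroup (HidaTest d) := inferInstanceAs (AddCommGroup (hidaSubmodule d))

instance (d : ℕ) : Module ℂ (HidaTest d) := inferInstanceAs (Module ℂ (hidaSubmodule d))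

/-- The inclusion `(M) ⊂ L²(μ_{1,d})`. -/
def HidaTest.toL2 {d : ℕ} : HidaTest d →ₗ[ℂ] L2 d := (hidaSubmodule d).subtype

/-- The weighted chaos coefficients `(2^{q|α|/2} ⟨h_α, φ⟩)_α ∈ ℓ²` of a test function. -/
def weightedCoeff (d q : ℕ) : HidaTest d →ₗ[ℂ] lp (fun _ : Idx d → ℕ => ℂ) 2 where
  toFun φ := ⟨fun α => ((√2 ^ (q * degree α) : ℝ) : ℂ) * chaosCoeff α (HidaTest.toL2 φ), by
    refine memℓp_gen ?_
    refine (φ.2 q).congr fun α => ?_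
    have : (√2 ^ (q * degree α)) ^ 2 = (2 : ℝ) ^ (q * degree α) := by
      rw [← pow_mul, mul_comm, pow_mul, Real.sq_sqrt (by norm_num)]
    simp only [ENNReal.toReal_ofNat, Real.rpow_ofNat, norm_mul, mul_pow, Complex.norm_real,
      Real.norm_eq_abs, sq_abs, this]
    rfl⟩
  map_add' φ ψ := by
    ext α
    simp only [chaosCoeff, map_add, inner_add_right, mul_add]
    rfl
  map_smul' c φ := by
    ext α
    simp [chaosCoeff, inner_smul_right, mul_left_comm]

/-- The Hilbertian norms `‖φ‖_q = (∑ₙ n! 2^{qn} |φ^{(n)}|²)^{1/2}`, `q ∈ ℕ`. -/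
def hidaSeminorm (d : ℕ) : SeminormFamily ℂ (HidaTest d) ℕ := fun q =>
  (normSeminorm ℂ (lp (fun _ : Idx d → ℕ => ℂ) 2)).comp (weightedCoeff d q)

lemma hidaSeminorm_sq {d : ℕ} (q : ℕ) (φ : HidaTest d) :
    hidaSeminorm d q φ ^ 2 =
      ∑' α : Idx d → ℕ, (2 : ℝ) ^ (q * degree α) * ‖chaosCoeff α φ.toL2‖ ^ 2 := by
  have h := lp.norm_rpow_eq_tsum (p := 2) (by simp) (weightedCoeff d q φ)
  simp only [ENNReal.toReal_ofNat, Real.rpow_ofNat] at h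
  refine h.trans (tsum_congr fun α => ?_)
  have : (√2 ^ (q * degree α)) ^ 2 = (2 : ℝ) ^ (q * degree α) := by
    rw [← pow_mul, mul_comm, pow_mul, Real.sq_sqrt (by norm_num)]
  simp only [weightedCoeff, LinearMap.coe_mk, AddHom.coe_mk, norm_mul, mul_pow,
    Complex.norm_real, Real.norm_eq_abs, sq_abs, this]

/-- The projective limit topology of `(M)`: the one generated by all the norms `‖·‖_q`. -/
instance (d : ℕ) : TopologicalSpace (HidaTest d) := (hidaSeminorm d).moduleFilterBasis.topology

lemma withSeminorms_hida (d : ℕ) : WithSeminorms (hidaSeminorm d) := ⟨rfl⟩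

instance (d : ℕ) : IsTopologicalAddGroup (HidaTest d) :=
  (withSeminorms_hida d).topologicalAddGroup

instance (d : ℕ) : ContinuousSMul ℂ (HidaTest d) := (withSeminorms_hida d).continuousSMul

/-- The space `(M)'` of Hida distributions: the topological dual of `(M)`, with the strong topology
(uniform convergence on the bounded subsets of `(M)`). The bilinear dual pairing `⟪Φ, φ⟫` is
the application `Φ φ`. -/
abbrev HidaDistribution (d : ℕ) : Type := StrongDual ℂ (HidaTest d)

/-- `U` is the `T`-transform of `Φ`: for every `F ∈ ℝ^{2d}` the function `exp (i ⟨·, F⟩)` is (the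
class of) a test function, and `U F = ⟪Φ, exp (i ⟨·, F⟩)⟫`. -/
def IsTTransform {d : ℕ} (Φ : HidaDistribution d) (U : Vec d → ℂ) : Prop :=
  ∀ F : Vec d, ∃ e : HidaTest d,
    (e.toL2 =ᵐ[gaussian d] fun x => Complex.exp (Complex.I * ((x ⬝ᵥ F : ℝ) : ℂ))) ∧ Φ e = U F

/-- `K_ε = -((1 - ε) Id + i [[0, Id], [Id, 0]])`. -/
def K (d : ℕ) (ε : ℝ) : Matrix (Idx d) (Idx d) ℂ :=
  -(((1 - ε : ℝ) : ℂ) • (1 : Matrix (Idx d) (Idx d) ℂ)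
    + Complex.I • Matrix.fromBlocks 0 1 1 0)

/-- The regularized symplectic Feynman distribution, as a function on `ℝ^{2d}`:
`Φ_{1,d,ε}(x) = (2π)^d exp (-(x, K_ε x) / 2)`. -/
def regularized (d : ℕ) (ε : ℝ) (x : Vec d) : ℂ :=
  (2 * (Real.pi : ℂ)) ^ d *
    Complex.exp (-(1 / 2) * ((fun i => (x i : ℂ)) ⬝ᵥ (K d ε *ᵥ fun i => (x i : ℂ))))

/-- The Hida distribution `Ψ` is given by the (not necessarily square-integrable) function `u`:
`⟪Ψ, φ⟫ = ∫ u φ dμ_{1,d}` for all test functions `φ`, the integrals being convergent. -/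
def IsGivenBy {d : ℕ} (Ψ : HidaDistribution d) (u : Vec d → ℂ) : Prop :=
  ∀ φ : HidaTest d, Integrable (fun x => u x * φ.toL2 x) (gaussian d) ∧
    Ψ φ = ∫ x, u x * φ.toL2 x ∂(gaussian d)

end SymplecticFeynman

end

noncomputable section

namespace SymplecticFeynman

/-! Against Lebesgue measure, the prefactor `(2π)^d` cancels the normalization of the Gaussian, and
the regularized kernel times the Gaussian density becomes a product over `μ` of `exp(-ε(a² + b²)/2 +
i a b)` with `a = a_μ`, `b = b_μ`. All integrals therefore reduce to two real variables.

Pairing with a test function is the series `∑ regCoeff ε α * chaosCoeff α φ`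
(`hasSum_regCoeff_mul_chaosCoeff`). Integration by parts gives a recurrence for the Hermite
coefficients whose factors stay bounded by 1 and are continuous at `ε = 0` (`hermitePair_succ`).
Hence `‖regCoeff ε α‖ ≤ (2π)^d 2^|α|` uniformly in `ε > 0`, and each coefficient converges as `ε ↓
0`. After division by `2^(3|α|/2)`, dominated convergence gives convergence in `ℓ²`
(`tendsto_weightedVec`), and the passage from `ℓ²` to the strong dual is continuous
(`continuous_ofWeighted`).

The limit is identified only on plane waves, where the integral for `ε > 0` is an explicit Gaussian
one (`regPair_cexp`). The chaos expansion behind the series needs completeness of the Hermite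
functions; it follows from Parseval's identity for plane waves and injectivity of the Fourier
transform. -/

/-! ### Hermite polynomials: recurrence and growth -/

/-- The probabilists' Hermite polynomials as real functions. -/
def He (n : ℕ) (x : ℝ) : ℝ := Polynomial.aeval x (Polynomial.hermite n)

/-- The truncated `n - 1` is harmless at `n = 0` because the factor `n` vanishes; the recurrences
below rely on the same convention. -/
lemma derivative_hermite (n : ℕ) :
    Polynomial.derivative (Polynomial.hermite n) = n * Polynomial.hermite (n - 1) := by
  induction n with
  | zero => simp
  | succ n ih =>
    rw [Polynomial.hermite_succ, Polynomial.derivative_sub, Polynomial.derivative_mul, ih]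
    rcases n with _ | n
    · simp
    · have h := Polynomial.hermite_succ n
      simp only [Nat.add_sub_cancel, Polynomial.derivative_mul, Polynomial.derivative_X,
        Polynomial.derivative_natCast] at ih ⊢
      rw [h]
      push_cast
      ring

lemma He_zero (x : ℝ) : He 0 x = 1 := by simp [He]

lemma He_succ (n : ℕ) (x : ℝ) : He (n + 1) x = x * He n x - n * He (n - 1) x := by
  simp [He, Polynomial.hermite_succ, derivative_hermite]

lemma hasDerivAt_He (n : ℕ) (x : ℝ) : HasDerivAt (He n) (n * He (n - 1) x) x := by
  have h := (Polynomial.hermite n).hasDerivAt_aeval x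
  rw [derivative_hermite] at h
  simp only [map_mul, map_natCast] at h
  exact h

lemma continuous_He (n : ℕ) : Continuous (He n) := Polynomial.continuous_aeval _

lemma sqrt_factorial_succ (n : ℕ) :
    √((n + 1).factorial : ℝ) = √(n + 1) * √(n.factorial : ℝ) := by
  rw [Nat.factorial_succ, Nat.cast_mul, Real.sqrt_mul (by positivity)]
  push_cast
  rfl

/-- Induction along the three-term recurrence. The factor `|x|` is absorbed by raising the exponent
from `√k |x|` to `√(k+1) |x|`, at the cost of a factor 2 (`key`); the lower-order term costs 1 more,
whence the base 3. -/
lemma abs_He_le (n : ℕ) (x : ℝ) :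
    |He n x| ≤ √(n.factorial : ℝ) * 3 ^ n * Real.exp (√n * |x|) := by
  have key : ∀ k : ℕ, |x| * √(k.factorial : ℝ) * Real.exp (√k * |x|) ≤
      2 * (√((k + 1).factorial : ℝ) * Real.exp (√(k + 1 : ℝ) * |x|)) := by
    intro k
    have hs : 0 < √(k + 1 : ℝ) := Real.sqrt_pos.2 (by positivity)
    -- The difference of the roots is `1 / (√(k+1) + √k)`, at least `1 / (2√(k+1))`.
    have h1 : (√(k + 1 : ℝ) - √k) * (2 * √(k + 1 : ℝ)) ≥ 1 := by
      have h2 := Real.sq_sqrt (show (0 : ℝ) ≤ k + 1 by positivity)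
      have h3 := Real.sq_sqrt (show (0 : ℝ) ≤ k by positivity)
      nlinarith [sq_nonneg (√(k + 1 : ℝ) - √k)]
    have h4 := Real.add_one_le_exp ((√(k + 1 : ℝ) - √k) * |x|)
    have h5 : |x| ≤ 2 * √(k + 1 : ℝ) * Real.exp ((√(k + 1 : ℝ) - √k) * |x|) := by
      have : |x| ≤ 2 * √(k + 1 : ℝ) * ((√(k + 1 : ℝ) - √k) * |x|) := by
        nlinarith [mul_le_mul_of_nonneg_right h1 (abs_nonneg x)]
      refine this.trans ?_
      gcongr
      linarith
    have h6 : Real.exp (√(k + 1 : ℝ) * |x|) =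
        Real.exp ((√(k + 1 : ℝ) - √k) * |x|) * Real.exp (√k * |x|) := by
      rw [← Real.exp_add]; ring_nf
    rw [sqrt_factorial_succ, h6]
    calc |x| * √(k.factorial : ℝ) * Real.exp (√k * |x|)
        ≤ (2 * √(k + 1 : ℝ) * Real.exp ((√(k + 1 : ℝ) - √k) * |x|)) * √(k.factorial : ℝ) *
          Real.exp (√k * |x|) := by gcongr
      _ = _ := by ring
  induction n using Nat.strong_induction_on with
  | _ n ih =>
    rcases n with _ | n
    · simp [He_zero]
    have hn := ih n (by omega)
    have hA : |x * He n x| ≤ 2 * 3 ^ n * (√((n + 1).factorial : ℝ) *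
        Real.exp (√(n + 1 : ℝ) * |x|)) := by
      rw [abs_mul]
      calc |x| * |He n x| ≤ |x| * (√(n.factorial : ℝ) * 3 ^ n * Real.exp (√n * |x|)) := by gcongr
        _ = 3 ^ n * (|x| * √(n.factorial : ℝ) * Real.exp (√n * |x|)) := by ring
        _ ≤ 3 ^ n * (2 * (√((n + 1).factorial : ℝ) * Real.exp (√(n + 1 : ℝ) * |x|))) := by
          exact mul_le_mul_of_nonneg_left (key n) (by positivity)
        _ = _ := by ring
    have hB : |n * He (n - 1) x| ≤ 3 ^ n * (√((n + 1).factorial : ℝ) *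
        Real.exp (√(n + 1 : ℝ) * |x|)) := by
      rcases n with _ | k
      · simp; positivity
      have hk := ih k (by omega)
      rw [Nat.add_sub_cancel, abs_mul, Nat.abs_cast]
      have h1 : ((k + 1 : ℕ) : ℝ) * √(k.factorial : ℝ) ≤ √((k + 1 + 1).factorial : ℝ) := by
        rw [sqrt_factorial_succ, sqrt_factorial_succ, ← mul_assoc]
        gcongr
        push_cast
        have h2 : √(k + 1 : ℝ) ≤ √((k : ℝ) + 1 + 1) := Real.sqrt_le_sqrt (by linarith)
        calc (k : ℝ) + 1 = √(k + 1 : ℝ) * √(k + 1 : ℝ) := by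
              rw [Real.mul_self_sqrt (by positivity)]
          _ ≤ _ := by gcongr
      calc ((k + 1 : ℕ) : ℝ) * |He k x|
          ≤ ((k + 1 : ℕ) : ℝ) * (√(k.factorial : ℝ) * 3 ^ k * Real.exp (√k * |x|)) := by gcongr
        _ = 3 ^ k * ((((k + 1 : ℕ) : ℝ) * √(k.factorial : ℝ)) * Real.exp (√k * |x|)) := by ring
        _ ≤ 3 ^ (k + 1) * (√((k + 1 + 1).factorial : ℝ) *
            Real.exp (√((k + 1 : ℕ) + 1 : ℝ) * |x|)) := by
          gcongr
          · norm_num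
          · omega
          · push_cast; linarith
    rw [He_succ]
    calc |x * He n x - n * He (n - 1) x| ≤ |x * He n x| + |n * He (n - 1) x| := abs_sub _ _
      _ ≤ 3 * 3 ^ n * (√((n + 1).factorial : ℝ) * Real.exp (√(n + 1 : ℝ) * |x|)) := by linarith
      _ = _ := by push_cast; ring

/-- Completing the square gives `√n |x| ≤ n/(4δ) + δ x²`, and the first term goes into `R ^ n`.
Arbitrarily small `δ` is needed because the regularized kernel leaves only the decay `exp(-ε x²/2)`.
-/
lemma exists_abs_He_le {δ : ℝ} (hδ : 0 < δ) :
    ∃ R : ℝ, 1 ≤ R ∧ ∀ (n : ℕ) (x : ℝ),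
      |He n x| ≤ √(n.factorial : ℝ) * R ^ n * Real.exp (δ * x ^ 2) := by
  refine ⟨3 * Real.exp (1 / (4 * δ)), ?_, fun n x => (abs_He_le n x).trans ?_⟩
  · have : 1 ≤ Real.exp (1 / (4 * δ)) := Real.one_le_exp (by positivity)
    linarith
  · have h : √n * |x| ≤ n * (1 / (4 * δ)) + δ * x ^ 2 := by
      have h1 := Real.sq_sqrt (Nat.cast_nonneg (α := ℝ) n)
      have h2 : 0 ≤ (√n - 2 * δ * |x|) ^ 2 / (4 * δ) := by positivity
      have h3 : (√n - 2 * δ * |x|) ^ 2 / (4 * δ) =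
          (√n) ^ 2 * (1 / (4 * δ)) - √n * |x| + δ * |x| ^ 2 := by field_simp; ring
      rw [h3, h1, sq_abs] at h2
      linarith
    calc _ ≤ √(n.factorial : ℝ) * 3 ^ n * Real.exp (n * (1 / (4 * δ)) + δ * x ^ 2) := by gcongr
      _ = _ := by rw [Real.exp_add, Real.exp_nat_mul, mul_pow]; ring

/-! ### Moderate growth and Gaussian integration by parts -/

/-- Continuous functions growing more slowly than every `exp (δ x²)`, `δ > 0`. -/
structure ModerateGrowth (p : ℝ → ℂ) : Prop where
  continuous : Continuous p
  bound : ∀ δ : ℝ, 0 < δ → ∃ C : ℝ, 0 ≤ C ∧ ∀ x, ‖p x‖ ≤ C * Real.exp (δ * x ^ 2)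

namespace ModerateGrowth

lemma mul {p q : ℝ → ℂ} (hp : ModerateGrowth p) (hq : ModerateGrowth q) :
    ModerateGrowth (fun x => p x * q x) where
  continuous := hp.continuous.mul hq.continuous
  bound δ hδ := by
    obtain ⟨C, hC, h⟩ := hp.bound (δ / 2) (by positivity)
    obtain ⟨D, hD, h'⟩ := hq.bound (δ / 2) (by positivity)
    refine ⟨C * D, by positivity, fun x => ?_⟩
    rw [norm_mul]
    calc ‖p x‖ * ‖q x‖ ≤ (C * Real.exp (δ / 2 * x ^ 2)) * (D * Real.exp (δ / 2 * x ^ 2)) :=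
          mul_le_mul (h x) (h' x) (norm_nonneg _) (by positivity)
      _ = C * D * (Real.exp (δ / 2 * x ^ 2) * Real.exp (δ / 2 * x ^ 2)) := by ring
      _ = _ := by rw [← Real.exp_add]; ring_nf

lemma add {p q : ℝ → ℂ} (hp : ModerateGrowth p) (hq : ModerateGrowth q) :
    ModerateGrowth (fun x => p x + q x) where
  continuous := hp.continuous.add hq.continuous
  bound δ hδ := by
    obtain ⟨C, hC, h⟩ := hp.bound δ hδ
    obtain ⟨D, hD, h'⟩ := hq.bound δ hδ
    exact ⟨C + D, by positivity, fun x =>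
      (norm_add_le _ _).trans (by linarith [h x, h' x])⟩

lemma const (c : ℂ) : ModerateGrowth (fun _ => c) where
  continuous := continuous_const
  bound δ hδ := ⟨‖c‖, norm_nonneg _, fun x =>
    le_mul_of_one_le_right (norm_nonneg _) (Real.one_le_exp (by positivity))⟩

lemma hermite (n : ℕ) : ModerateGrowth (fun x => (He n x : ℂ)) where
  continuous := Complex.continuous_ofReal.comp (continuous_He n)
  bound δ hδ := by
    obtain ⟨R, hR, h⟩ := exists_abs_He_le hδ
    exact ⟨√(n.factorial : ℝ) * R ^ n, by positivity, fun x => by simpa using h n x⟩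

lemma ofReal : ModerateGrowth (fun x : ℝ => (x : ℂ)) := by
  have h := hermite 1
  have h1 : (fun x : ℝ => ((He 1 x : ℝ) : ℂ)) = fun x : ℝ => (x : ℂ) := by
    funext x; simp [He]
  rwa [h1] at h

lemma cexp (c : ℂ) : ModerateGrowth (fun x => Complex.exp (c * x)) where
  continuous := by fun_prop
  bound δ hδ := by
    refine ⟨Real.exp (c.re ^ 2 / (4 * δ)), by positivity, fun x => ?_⟩
    rw [Complex.norm_exp, ← Real.exp_add, Real.exp_le_exp]
    have h2 : 0 ≤ (c.re - 2 * δ * x) ^ 2 / (4 * δ) := by positivity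
    have h3 : (c.re - 2 * δ * x) ^ 2 / (4 * δ) = c.re ^ 2 / (4 * δ) - c.re * x + δ * x ^ 2 := by
      field_simp; ring
    rw [h3] at h2
    simp
    linarith

/-- Gaussian factors of any width make functions of moderate growth integrable. -/
lemma integrable {p : ℝ → ℂ} (hp : ModerateGrowth p) {ε : ℝ} (hε : 0 < ε) :
    Integrable (fun x : ℝ => Complex.exp (-(ε / 2) * x ^ 2) * p x) := by
  obtain ⟨C, hC, h⟩ := hp.bound (ε / 4) (by positivity)
  refine ((integrable_exp_neg_mul_sq (show 0 < ε / 4 by positivity)).const_mul C).mono'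
    (Continuous.aestronglyMeasurable (by have := hp.continuous; fun_prop))
    (Eventually.of_forall fun x => ?_)
  rw [norm_mul, Complex.norm_exp]
  have h1 : (-((ε : ℂ) / 2) * (x : ℂ) ^ 2).re = -(ε / 2) * x ^ 2 := by
    rw [← Complex.ofReal_re (-(ε / 2) * x ^ 2)]; push_cast; rfl
  rw [h1]
  calc Real.exp (-(ε / 2) * x ^ 2) * ‖p x‖
      ≤ Real.exp (-(ε / 2) * x ^ 2) * (C * Real.exp (ε / 4 * x ^ 2)) := by gcongr; exact h x
    _ = C * (Real.exp (-(ε / 2) * x ^ 2) * Real.exp (ε / 4 * x ^ 2)) := by ring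
    _ = _ := by rw [← Real.exp_add]; ring_nf

end ModerateGrowth

lemma hasDerivAt_gauss (ε : ℝ) (x : ℝ) :
    HasDerivAt (fun x : ℝ => Complex.exp (-(ε / 2) * x ^ 2))
      (-(ε * x) * Complex.exp (-(ε / 2) * x ^ 2)) x := by
  have h : HasDerivAt (fun z : ℂ => Complex.exp (-(ε / 2) * z ^ 2))
      (Complex.exp (-(ε / 2) * (x : ℂ) ^ 2) * (-(ε / 2) * (2 * (x : ℂ)))) (x : ℂ) := by
    simpa using ((hasDerivAt_pow 2 (x : ℂ)).const_mul (-((ε : ℂ) / 2))).cexp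
  convert h.comp_ofReal using 1
  ring

/-- Integration by parts against a Gaussian factor. -/
lemma integral_gauss_mul_deriv {ε : ℝ} (hε : 0 < ε) {p p' : ℝ → ℂ} (hp : ModerateGrowth p)
    (hp' : ModerateGrowth p') (hd : ∀ x, HasDerivAt p (p' x) x) :
    ∫ x : ℝ, Complex.exp (-(ε / 2) * x ^ 2) * p' x =
      ε * ∫ x : ℝ, Complex.exp (-(ε / 2) * x ^ 2) * (x * p x) := by
  have h1 := hp'.integrable hε
  have h2 := (ModerateGrowth.ofReal.mul hp).integrable hε
  have h := integral_eq_zero_of_hasDerivAt_of_integrable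
    (f := fun x : ℝ => Complex.exp (-(ε / 2) * x ^ 2) * p x)
    (f' := fun x : ℝ => Complex.exp (-(ε / 2) * x ^ 2) * p' x -
      ε * (Complex.exp (-(ε / 2) * x ^ 2) * (x * p x)))
    (fun x => by
      refine ((hasDerivAt_gauss ε x).mul (hd x)).congr_deriv ?_
      ring) (h1.sub (h2.const_mul _)) (hp.integrable hε)
  rw [integral_sub h1 (h2.const_mul _), integral_const_mul, sub_eq_zero] at h
  exact h

lemma integral_gaussianReal_eq (p : ℝ → ℂ) :
    ∫ x, p x ∂(gaussianReal 0 1) = ((√(2 * Real.pi))⁻¹ : ℝ) *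
      ∫ x : ℝ, Complex.exp (-((1 : ℝ) / 2) * x ^ 2) * p x := by
  rw [integral_gaussianReal_eq_integral_smul (by simp), ← integral_const_mul]
  refine integral_congr_ae (Eventually.of_forall fun x => ?_)
  simp only [gaussianPDFReal, Complex.real_smul]
  push_cast
  rw [mul_assoc]
  congr 2
  · simp
  · simp
    ring_nf

lemma integrable_gaussianReal_exp {κ : ℝ} (hκ : κ < 1 / 2) :
    Integrable (fun x => Real.exp (κ * x ^ 2)) (gaussianReal 0 1) := by
  rw [gaussianReal_of_var_ne_zero _ (by simp), gaussianPDF_def,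
    integrable_withDensity_iff_integrable_smul₀' (by fun_prop) (by simp)]
  have h := (integrable_exp_neg_mul_sq (show 0 < 1 / 2 - κ by linarith)).const_mul
    ((√(2 * Real.pi))⁻¹)
  refine h.congr (Eventually.of_forall fun x => ?_)
  simp only [gaussianPDFReal, smul_eq_mul]
  rw [ENNReal.toReal_ofReal (by positivity), mul_assoc, ← Real.exp_add]
  congr 2
  · simp
  · simp
    ring_nf

lemma integrable_gaussianReal_of_moderate {p : ℝ → ℂ} (hp : ModerateGrowth p) :
    Integrable p (gaussianReal 0 1) := by
  obtain ⟨C, hC, h⟩ := hp.bound (1 / 4) (by positivity)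
  exact ((integrable_gaussianReal_exp (show (1 / 4 : ℝ) < 1 / 2 by norm_num)).const_mul C).mono'
    hp.continuous.aestronglyMeasurable (Eventually.of_forall h)

/-- Since `He (n+1) · exp(-x²/2)` is minus the derivative of `He n · exp(-x²/2)`, a Hermite index
can be traded for a derivative of `p`. Orthogonality and the Hermite coefficients of plane waves
both follow by induction. -/
lemma integral_gaussianReal_He_succ_mul (n : ℕ) {p p' : ℝ → ℂ} (hp : ModerateGrowth p)
    (hp' : ModerateGrowth p') (hd : ∀ x, HasDerivAt p (p' x) x) :
    ∫ x, (He (n + 1) x : ℂ) * p x ∂(gaussianReal 0 1) =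
      ∫ x, (He n x : ℂ) * p' x ∂(gaussianReal 0 1) := by
  have hH := ModerateGrowth.hermite
  have hN : ModerateGrowth (fun x => (n : ℂ) * (He (n - 1) x : ℂ)) := (ModerateGrowth.const n).mul (hH _)
  have h := integral_gauss_mul_deriv one_pos ((hH n).mul hp) ((hN.mul hp).add ((hH n).mul hp'))
    (fun x => by
      have h1 := (hasDerivAt_He n x).ofReal_comp
      push_cast at h1
      exact h1.mul (hd x))
  rw [Complex.ofReal_one, one_mul] at h
  have e1 := integral_gaussianReal_eq (fun x => (n : ℂ) * (He (n - 1) x : ℂ) * p x + (He n x : ℂ) * p' x)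
  have e2 := integral_gaussianReal_eq (fun x => (x : ℂ) * ((He n x : ℂ) * p x))
  rw [Complex.ofReal_one] at e1 e2
  rw [h, ← e2, integral_add (integrable_gaussianReal_of_moderate (hN.mul hp))
    (integrable_gaussianReal_of_moderate ((hH n).mul hp'))] at e1
  have e3 : ∀ x, (He (n + 1) x : ℂ) * p x =
      (x : ℂ) * ((He n x : ℂ) * p x) - (n : ℂ) * (He (n - 1) x : ℂ) * p x := by
    intro x; rw [He_succ]; push_cast; ring
  simp_rw [e3]
  rw [integral_sub (integrable_gaussianReal_of_moderate
    (ModerateGrowth.ofReal.mul ((hH n).mul hp)))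
    (integrable_gaussianReal_of_moderate (hN.mul hp)), ← e1]
  ring

lemma integral_He_mul_He (m n : ℕ) :
    ∫ x, (He m x : ℂ) * (He n x : ℂ) ∂(gaussianReal 0 1) =
      if m = n then (n.factorial : ℂ) else 0 := by
  have hH := ModerateGrowth.hermite
  have h (m n : ℕ) : ∫ x, (He (m + 1) x : ℂ) * (He n x : ℂ) ∂(gaussianReal 0 1) =
      n * ∫ x, (He m x : ℂ) * (He (n - 1) x : ℂ) ∂(gaussianReal 0 1) := by
    rw [integral_gaussianReal_He_succ_mul m (hH n) ((ModerateGrowth.const n).mul (hH (n - 1)))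
      (fun x => by
        have h1 := (hasDerivAt_He n x).ofReal_comp
        push_cast at h1
        exact h1), ← integral_const_mul]
    congr 1
    funext x
    ring
  induction m generalizing n with
  | zero =>
    rcases n with _ | n
    · simp [He_zero]
    · simp_rw [mul_comm (He 0 _ : ℂ)]
      rw [h]
      simp
  | succ m ih =>
    rw [h, ih]
    rcases n with _ | n
    · simp
    · simp [Nat.factorial_succ]

lemma integral_He_mul_cexp (n : ℕ) (t : ℝ) :
    ∫ x, (He n x : ℂ) * Complex.exp (Complex.I * t * x) ∂(gaussianReal 0 1) =
      (Complex.I * t) ^ n * Complex.exp (-(t ^ 2 / 2)) := by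
  have hE := ModerateGrowth.cexp (Complex.I * t)
  induction n with
  | zero =>
    have h := charFun_gaussianReal (μ := 0) (v := 1) t
    rw [charFun_apply_real] at h
    simp only [He_zero, Complex.ofReal_one, one_mul, pow_zero]
    convert h using 1
    · congr 1; funext x; ring_nf
    · congr 1; simp
  | succ n ih =>
    rw [integral_gaussianReal_He_succ_mul n hE ((ModerateGrowth.const (Complex.I * t)).mul hE)
      (fun x => by
        have h : HasDerivAt (fun z : ℂ => Complex.exp (Complex.I * t * z))
            (Complex.exp (Complex.I * t * x) * (Complex.I * t)) (x : ℂ) := by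
          simpa using ((hasDerivAt_id (x : ℂ)).const_mul (Complex.I * t)).cexp
        convert h.comp_ofReal using 1
        ring), pow_succ']
    rw [mul_assoc, ← ih, ← integral_const_mul]
    congr 1
    funext x
    ring

/-! ### The oscillatory Gaussian integral of one coordinate pair -/

/-- The oscillatory Gaussian density `exp (-ε (a² + b²) / 2 + i a b)` times `p a * q b`. -/
def pairIntegrand (ε : ℝ) (p q : ℝ → ℂ) (z : ℝ × ℝ) : ℂ :=
  (Complex.exp (-(ε / 2) * z.1 ^ 2) * p z.1) * (Complex.exp (-(ε / 2) * z.2 ^ 2) * q z.2) *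
    Complex.exp (Complex.I * (z.1 * z.2))

/-- The integral of `p a * q b` against `exp (-ε (a² + b²) / 2 + i a b)`. -/
def regPair (ε : ℝ) (p q : ℝ → ℂ) : ℂ := ∫ z : ℝ × ℝ, pairIntegrand ε p q z

section

variable {ε : ℝ} {p q r : ℝ → ℂ}

lemma integrable_pairIntegrand (hε : 0 < ε) (hp : ModerateGrowth p) (hq : ModerateGrowth q) :
    Integrable (pairIntegrand ε p q) := by
  have h := (hp.integrable hε).mul_prod (hq.integrable hε)
  refine h.mul_bdd (c := 1) (Continuous.aestronglyMeasurable (by fun_prop))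
    (Eventually.of_forall fun z => ?_)
  rw [← Complex.ofReal_mul, mul_comm, Complex.norm_exp_ofReal_mul_I]

lemma regPair_comm (p q : ℝ → ℂ) : regPair ε p q = regPair ε q p := by
  unfold regPair
  rw [Measure.volume_eq_prod, ← integral_prod_swap]
  congr 1
  funext z
  simp only [pairIntegrand, Prod.fst_swap, Prod.snd_swap]
  rw [mul_comm (z.2 : ℂ)]
  ring

lemma regPair_add_left (hε : 0 < ε) (hp : ModerateGrowth p) (hq : ModerateGrowth q)
    (hr : ModerateGrowth r) :
    regPair ε (fun x => p x + q x) r = regPair ε p r + regPair ε q r := by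
  unfold regPair
  rw [← integral_add (integrable_pairIntegrand hε hp hr) (integrable_pairIntegrand hε hq hr)]
  congr 1
  funext z
  simp only [pairIntegrand]
  ring

lemma regPair_const_mul_left (c : ℂ) (p r : ℝ → ℂ) :
    regPair ε (fun x => c * p x) r = c * regPair ε p r := by
  unfold regPair
  rw [← integral_const_mul]
  congr 1
  funext z
  simp only [pairIntegrand]
  ring

lemma regPair_eq_iterated (hε : 0 < ε) (hp : ModerateGrowth p) (hq : ModerateGrowth q) :
    regPair ε p q = ∫ b : ℝ, ∫ a : ℝ, pairIntegrand ε p q (a, b) := by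
  unfold regPair
  exact integral_prod_symm _ (integrable_pairIntegrand hε hp hq)

/-- Integration by parts in `a`: differentiating the density brings down `-ε a + i b`. -/
lemma regPair_deriv_left (hε : 0 < ε) {p' : ℝ → ℂ} (hp : ModerateGrowth p)
    (hp' : ModerateGrowth p') (hq : ModerateGrowth q) (hd : ∀ x, HasDerivAt p (p' x) x) :
    ε * regPair ε (fun x => x * p x) q =
      regPair ε p' q + Complex.I * regPair ε p (fun x => x * q x) := by
  have h1 := integrable_pairIntegrand hε hp' hq
  have h2 := integrable_pairIntegrand hε hp (ModerateGrowth.ofReal.mul hq)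
  have h3 := integrable_pairIntegrand hε (ModerateGrowth.ofReal.mul hp) hq
  have h12 : Integrable (fun z => pairIntegrand ε p' q z +
      Complex.I * pairIntegrand ε p (fun x => x * q x) z) := h1.add (h2.const_mul _)
  have h123 : Integrable (fun z => pairIntegrand ε p' q z +
      Complex.I * pairIntegrand ε p (fun x => x * q x) z -
      ε * pairIntegrand ε (fun x => x * p x) q z) := h12.sub (h3.const_mul _)
  have h4 : regPair ε p' q + Complex.I * regPair ε p (fun x => x * q x) -
      ε * regPair ε (fun x => x * p x) q = ∫ z : ℝ × ℝ, (pairIntegrand ε p' q z +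
        Complex.I * pairIntegrand ε p (fun x => x * q x) z -
        ε * pairIntegrand ε (fun x => x * p x) q z) := by
    rw [integral_sub h12 (h3.const_mul _),
      integral_add h1 (h2.const_mul _), integral_const_mul, integral_const_mul]
    rfl
  have h5 : ∫ z : ℝ × ℝ, (pairIntegrand ε p' q z +
        Complex.I * pairIntegrand ε p (fun x => x * q x) z -
        ε * pairIntegrand ε (fun x => x * p x) q z) = 0 := by
    rw [Measure.volume_eq_prod, integral_prod_symm _ h123]
    refine (integral_congr_ae (Eventually.of_forall fun b => ?_)).trans (integral_zero _ _)
    -- For fixed `b` the oscillation `exp(i a b)` has moderate growth in `a`, so it joins `p` and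
    -- the one-variable formula applies.
    have hE := ModerateGrowth.cexp (Complex.I * b)
    have hpE' := (hp'.mul hE).add ((ModerateGrowth.const (Complex.I * b)).mul (hp.mul hE))
    have h := integral_gauss_mul_deriv hε (hp.mul hE) hpE'
      (fun x => by
        have h : HasDerivAt (fun z : ℂ => Complex.exp (Complex.I * b * z))
            (Complex.exp (Complex.I * b * x) * (Complex.I * b)) (x : ℂ) := by
          simpa using ((hasDerivAt_id (x : ℂ)).const_mul (Complex.I * b)).cexp
        refine ((hd x).mul h.comp_ofReal).congr_deriv ?_
        ring)
    have hi := hpE'.integrable hε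
    have hi' := (ModerateGrowth.ofReal.mul (hp.mul hE)).integrable hε
    rw [← sub_eq_zero, ← integral_const_mul, ← integral_sub hi (hi'.const_mul _)] at h
    have h6 := congrArg (fun w => Complex.exp (-(ε / 2) * b ^ 2) * q b * w) h
    simp only [mul_zero, ← integral_const_mul] at h6
    refine Eq.trans ?_ h6
    congr 1
    funext a
    have e : Complex.exp (Complex.I * b * a) = Complex.exp (Complex.I * (a * b)) := by
      ring_nf
    simp only [pairIntegrand, e]
    ring
  rw [h5, sub_eq_zero] at h4
  exact h4.symm

end

/-- The Hermite coefficients of the oscillatory Gaussian density. -/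
def hermitePair (ε : ℝ) (m n : ℕ) : ℂ := regPair ε (fun x => He m x) (fun x => He n x)

lemma hermitePair_comm (ε : ℝ) (m n : ℕ) : hermitePair ε m n = hermitePair ε n m :=
  regPair_comm _ _

/-- Integrating by parts in `a` and in `b` gives two linear equations for the pairings with an extra
factor `a` or `b`. The determinant is `ε² + 1`, so the solution remains regular at `ε = 0`. -/
lemma hermitePair_succ {ε : ℝ} (hε : 0 < ε) (m n : ℕ) :
    hermitePair ε (m + 1) n = ((ε / (ε ^ 2 + 1) - 1 : ℝ) : ℂ) * (m * hermitePair ε (m - 1) n) +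
      ((1 / (ε ^ 2 + 1) : ℝ) : ℂ) * Complex.I * (n * hermitePair ε m (n - 1)) := by
  have hH := ModerateGrowth.hermite
  have key (m n : ℕ) : ε * regPair ε (fun x => x * He m x) (fun x => He n x) =
      m * hermitePair ε (m - 1) n +
        Complex.I * regPair ε (fun x => He m x) (fun x => x * He n x) := by
    rw [regPair_deriv_left hε (hH m) ((ModerateGrowth.const m).mul (hH (m - 1))) (hH n)
      (fun x => by
        have h1 := (hasDerivAt_He m x).ofReal_comp
        push_cast at h1
        exact h1), regPair_const_mul_left]
    rfl
  have h1 := key m n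
  -- The equation from the second variable, obtained from the first by symmetry.
  have h2 := key n m
  rw [regPair_comm, regPair_comm (fun x => (He n x : ℂ)), hermitePair_comm] at h2
  have h3 : regPair ε (fun x => x * He m x) (fun x => He n x) =
      hermitePair ε (m + 1) n + m * hermitePair ε (m - 1) n := by
    unfold hermitePair
    rw [← regPair_const_mul_left, ← regPair_add_left hε (hH _)
      ((ModerateGrowth.const m).mul (hH (m - 1))) (hH n)]
    congr 1
    funext x
    rw [He_succ]
    push_cast
    ring
  rw [h3] at h1 h2
  have h4 : ((ε : ℂ) ^ 2 + 1) ≠ 0 := by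
    have : (0 : ℝ) < ε ^ 2 + 1 := by positivity
    exact_mod_cast this.ne'
  push_cast
  field_simp
  linear_combination (ε : ℂ) * h1 + Complex.I * h2 +
    (hermitePair ε (m + 1) n + m * hermitePair ε (m - 1) n) * Complex.I_sq

lemma ofReal_cpow_half {r : ℝ} (hr : 0 ≤ r) : (r : ℂ) ^ (1 / 2 : ℂ) = (√r : ℝ) := by
  rw [Real.sqrt_eq_rpow, Complex.ofReal_cpow hr]
  norm_num

/-- Two successive Gaussian integrals. Integrating out `a` changes the coefficient of `b²` from
`-ε/2` to `-(ε² + 1)/(2ε)`; both quadratic coefficients are real and negative, so the complex square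
roots are ordinary real ones. -/
lemma regPair_cexp {ε : ℝ} (hε : 0 < ε) (f g : ℝ) :
    regPair ε (fun x => Complex.exp (Complex.I * f * x)) (fun x => Complex.exp (Complex.I * g * x)) =
      ((2 * Real.pi / √(ε ^ 2 + 1) : ℝ) : ℂ) *
        Complex.exp (-(ε * f ^ 2 + 2 * Complex.I * f * g + ε * g ^ 2) / (2 * (ε ^ 2 + 1))) := by
  have hε' : (ε : ℂ) ≠ 0 := by exact_mod_cast hε.ne'
  have h4 : ((ε : ℂ) ^ 2 + 1) ≠ 0 := by
    have : (0 : ℝ) < ε ^ 2 + 1 := by positivity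
    exact_mod_cast this.ne'
  rw [regPair_eq_iterated hε (ModerateGrowth.cexp _) (ModerateGrowth.cexp _)]
  have h1 (b : ℝ) : ∫ a : ℝ, pairIntegrand ε (fun x => Complex.exp (Complex.I * f * x))
      (fun x => Complex.exp (Complex.I * g * x)) (a, b) =
      (√(2 * Real.pi / ε) : ℝ) * Complex.exp (((-((ε ^ 2 + 1) / (2 * ε)) : ℝ) : ℂ) * b ^ 2 +
        (Complex.I * g - f / ε) * b + -(f ^ 2 / (2 * ε))) := by
    have h := integral_cexp_quadratic (b := ((-(ε / 2) : ℝ) : ℂ))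
      (by rw [Complex.ofReal_re]; linarith) (Complex.I * (f + b))
      (-(ε / 2) * b ^ 2 + Complex.I * g * b)
    rw [show (Real.pi / -((-(ε / 2) : ℝ) : ℂ)) = ((2 * Real.pi / ε : ℝ) : ℂ) by
      push_cast; field_simp, ofReal_cpow_half (by positivity)] at h
    rw [show (fun a : ℝ => pairIntegrand ε (fun x => Complex.exp (Complex.I * f * x))
      (fun x => Complex.exp (Complex.I * g * x)) (a, b)) = fun a : ℝ =>
        Complex.exp (((-(ε / 2) : ℝ) : ℂ) * a ^ 2 + Complex.I * (f + b) * a +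
          (-(ε / 2) * b ^ 2 + Complex.I * g * b)) from ?_, h]
    · congr 2
      push_cast
      field_simp
      linear_combination (4 * (f + b) ^ 2 : ℂ) * Complex.I_sq
    · funext a
      simp only [pairIntegrand, ← Complex.exp_add]
      congr 1
      push_cast
      ring
  simp_rw [h1]
  rw [integral_const_mul, integral_cexp_quadratic
    (by rw [Complex.ofReal_re]; exact neg_lt_zero.2 (by positivity)),
    show (Real.pi / -((-((ε ^ 2 + 1) / (2 * ε)) : ℝ) : ℂ)) =
      ((2 * Real.pi * ε / (ε ^ 2 + 1) : ℝ) : ℂ) by push_cast; field_simp,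
    ofReal_cpow_half (by positivity), ← mul_assoc, ← Complex.ofReal_mul,
    ← Real.sqrt_mul (by positivity)]
  congr 2
  · rw [show 2 * Real.pi / ε * (2 * Real.pi * ε / (ε ^ 2 + 1)) =
      (2 * Real.pi) ^ 2 / (ε ^ 2 + 1) by field_simp, Real.sqrt_div (by positivity),
      Real.sqrt_sq (by positivity)]
  · push_cast
    field_simp
    linear_combination (4 * g ^ 2 * ε ^ 2 : ℂ) * Complex.I_sq

lemma hermitePair_zero_zero {ε : ℝ} (hε : 0 < ε) :
    hermitePair ε 0 0 = ((2 * Real.pi / √(ε ^ 2 + 1) : ℝ) : ℂ) := by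
  have h := regPair_cexp hε 0 0
  simpa [hermitePair, He_zero] using h

/-- Both factors in `hermitePair_succ` have modulus at most 1 whatever `ε > 0`, and the two terms
obey the same bound; their sum accounts for one power of 2 per step. -/
lemma norm_hermitePair_le {ε : ℝ} (hε : 0 < ε) (m n : ℕ) :
    ‖hermitePair ε m n‖ ≤
      2 * Real.pi * 2 ^ (m + n) * (√(m.factorial : ℝ) * √(n.factorial : ℝ)) := by
  induction hN : m + n using Nat.strong_induction_on generalizing m n with
  | _ N ih =>
    subst hN
    -- The recurrence is applied to the larger index: for the pair `(m + 1, n)` the second term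
    -- carries a factor `n`, which must be at most `√(m+1) √n`.
    wlog hmn : n ≤ m generalizing m n
    · have := this n m (fun k hk a b => ih k (by omega) a b) (by omega)
      rw [hermitePair_comm, add_comm m n, mul_comm √(m.factorial : ℝ)]
      exact this
    have hpi := Real.pi_pos
    rcases m with _ | m
    · obtain rfl : n = 0 := by omega
      rw [hermitePair_zero_zero hε, Complex.norm_real, Real.norm_of_nonneg (by positivity)]
      have h1 : 1 ≤ √(ε ^ 2 + 1) := Real.one_le_sqrt.2 (by nlinarith [sq_nonneg ε])
      simpa using div_le_self (by positivity) h1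
    have hc1 : ‖((ε / (ε ^ 2 + 1) - 1 : ℝ) : ℂ)‖ ≤ 1 := by
      rw [Complex.norm_real, Real.norm_eq_abs, abs_le]
      have h0 : 0 ≤ ε / (ε ^ 2 + 1) := by positivity
      have h1 : ε / (ε ^ 2 + 1) ≤ 1 := by
        rw [div_le_one (by positivity)]
        nlinarith [sq_nonneg (ε - 1)]
      constructor <;> linarith
    have hc2 : ‖((1 / (ε ^ 2 + 1) : ℝ) : ℂ) * Complex.I‖ ≤ 1 := by
      rw [norm_mul, Complex.norm_I, mul_one, Complex.norm_real, Real.norm_of_nonneg (by positivity),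
        div_le_one (by positivity)]
      nlinarith [sq_nonneg ε]
    set Q := √((m + 1).factorial : ℝ) * √(n.factorial : ℝ) with hQ
    have hQ0 : 0 ≤ Q := by positivity
    have hA : ‖(m : ℂ) * hermitePair ε (m - 1) n‖ ≤ 2 * Real.pi * 2 ^ (m + n) * Q := by
      rcases m with _ | m
      · simp; positivity
      rw [norm_mul, Complex.norm_natCast, Nat.add_sub_cancel]
      have h := ih (m + n) (by omega) m n rfl
      have h1 : ((m + 1 : ℕ) : ℝ) * √(m.factorial : ℝ) ≤ √((m + 1 + 1).factorial : ℝ) := by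
        rw [sqrt_factorial_succ, sqrt_factorial_succ, ← mul_assoc]
        gcongr
        push_cast
        have h2 : √(m + 1 : ℝ) ≤ √((m : ℝ) + 1 + 1) := Real.sqrt_le_sqrt (by linarith)
        calc (m : ℝ) + 1 = √(m + 1 : ℝ) * √(m + 1 : ℝ) := by
              rw [Real.mul_self_sqrt (by positivity)]
          _ ≤ _ := by gcongr
      calc ((m + 1 : ℕ) : ℝ) * ‖hermitePair ε m n‖
          ≤ ((m + 1 : ℕ) : ℝ) * (2 * Real.pi * 2 ^ (m + n) *
            (√(m.factorial : ℝ) * √(n.factorial : ℝ))) := by gcongr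
        _ = 2 * Real.pi * 2 ^ (m + n) *
            ((((m + 1 : ℕ) : ℝ) * √(m.factorial : ℝ)) * √(n.factorial : ℝ)) := by ring
        _ ≤ 2 * Real.pi * 2 ^ (m + 1 + n) * Q := by
          rw [hQ]
          gcongr
          · norm_num
          · omega
    have hB : ‖(n : ℂ) * hermitePair ε m (n - 1)‖ ≤ 2 * Real.pi * 2 ^ (m + n) * Q := by
      rcases n with _ | n
      · simp; positivity
      rw [norm_mul, Complex.norm_natCast, Nat.add_sub_cancel]
      have h := ih (m + n) (by omega) m n rfl
      have h1 : ((n + 1 : ℕ) : ℝ) * (√(m.factorial : ℝ) * √(n.factorial : ℝ)) ≤ Q := by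
        rw [hQ, sqrt_factorial_succ, sqrt_factorial_succ]
        have h2 : √(n + 1 : ℝ) ≤ √((m : ℝ) + 1) := Real.sqrt_le_sqrt (by
          have : ((n + 1 : ℕ) : ℝ) ≤ (m + 1 : ℕ) := by exact_mod_cast hmn
          push_cast at this; exact this)
        calc ((n + 1 : ℕ) : ℝ) * (√(m.factorial : ℝ) * √(n.factorial : ℝ))
            = √(n + 1 : ℝ) * √(n + 1 : ℝ) * (√(m.factorial : ℝ) * √(n.factorial : ℝ)) := by
              rw [Real.mul_self_sqrt (by positivity)]; push_cast; ring
          _ ≤ √(m + 1 : ℝ) * √(n + 1 : ℝ) * (√(m.factorial : ℝ) * √(n.factorial : ℝ)) := by gcongr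
          _ = _ := by ring
      calc ((n + 1 : ℕ) : ℝ) * ‖hermitePair ε m n‖
          ≤ ((n + 1 : ℕ) : ℝ) * (2 * Real.pi * 2 ^ (m + n) *
            (√(m.factorial : ℝ) * √(n.factorial : ℝ))) := by gcongr
        _ = 2 * Real.pi * 2 ^ (m + n) *
            (((n + 1 : ℕ) : ℝ) * (√(m.factorial : ℝ) * √(n.factorial : ℝ))) := by ring
        _ ≤ 2 * Real.pi * 2 ^ (m + (n + 1)) * Q := by
          gcongr
          · norm_num
          · omega
    rw [hermitePair_succ hε]
    calc _ ≤ ‖((ε / (ε ^ 2 + 1) - 1 : ℝ) : ℂ)‖ * ‖(m : ℂ) * hermitePair ε (m - 1) n‖ +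
          ‖((1 / (ε ^ 2 + 1) : ℝ) : ℂ) * Complex.I‖ * ‖(n : ℂ) * hermitePair ε m (n - 1)‖ := by
          refine (norm_add_le _ _).trans_eq ?_
          rw [norm_mul, norm_mul (_ * Complex.I)]
      _ ≤ 1 * (2 * Real.pi * 2 ^ (m + n) * Q) + 1 * (2 * Real.pi * 2 ^ (m + n) * Q) := by gcongr
      _ = _ := by ring

/-- The factors of the recurrence are continuous at `ε = 0`. Existence of the limits suffices, since
plane waves later identify the limiting distribution. -/
lemma exists_tendsto_hermitePair (m n : ℕ) :
    ∃ l : ℂ, Tendsto (fun ε => hermitePair ε m n) (𝓝[>] 0) (𝓝 l) := by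
  induction hN : m + n using Nat.strong_induction_on generalizing m n with
  | _ N ih =>
    subst hN
    wlog hm : m ≠ 0 ∨ n = 0 generalizing m n
    · obtain ⟨l, hl⟩ := this n m (fun k hk a b => ih k (by omega) a b) (by omega)
      exact ⟨l, hl.congr fun ε => hermitePair_comm _ _ _⟩
    have hpos : ∀ᶠ ε : ℝ in 𝓝[>] 0, 0 < ε := self_mem_nhdsWithin
    rcases m with _ | m
    · obtain rfl : n = 0 := by simpa using hm
      have h : Continuous fun ε : ℝ => ((2 * Real.pi / √(ε ^ 2 + 1) : ℝ) : ℂ) :=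
        Complex.continuous_ofReal.comp (continuous_const.div (by fun_prop)
          fun ε => (Real.sqrt_pos.2 (by positivity)).ne')
      exact ⟨_, ((h.tendsto 0).mono_left nhdsWithin_le_nhds).congr'
        (hpos.mono fun ε hε => (hermitePair_zero_zero hε).symm)⟩
    · obtain ⟨l₁, h₁⟩ := ih (m - 1 + n) (by omega) (m - 1) n rfl
      obtain ⟨l₂, h₂⟩ := ih (m + (n - 1)) (by omega) m (n - 1) rfl
      have hc : Continuous fun ε : ℝ => ((ε / (ε ^ 2 + 1) - 1 : ℝ) : ℂ) :=
        Complex.continuous_ofReal.comp ((continuous_id.div (by fun_prop)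
          fun ε => by positivity).sub continuous_const)
      have hc' : Continuous fun ε : ℝ => ((1 / (ε ^ 2 + 1) : ℝ) : ℂ) :=
        Complex.continuous_ofReal.comp (continuous_const.div (by fun_prop)
          fun ε => by positivity)
      exact ⟨_, ((((hc.tendsto 0).mono_left nhdsWithin_le_nhds).mul (h₁.const_mul (m : ℂ))).add
        ((((hc'.tendsto 0).mono_left nhdsWithin_le_nhds).mul_const Complex.I).mul
          (h₂.const_mul (n : ℂ)))).congr'
        (hpos.mono fun ε hε => (hermitePair_succ hε m n).symm)⟩

/-! ### Hermite functions, plane waves and completeness -/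

/-- A product of sums of nonnegative series is the sum over all multi-indices. -/
lemma hasSum_prod_pi {ι : Type*} [Fintype ι] {f : ι → ℕ → ℝ} {s : ι → ℝ}
    (hf : ∀ i n, 0 ≤ f i n) (hs : ∀ i, HasSum (f i) (s i)) :
    HasSum (fun α : ι → ℕ => ∏ i, f i (α i)) (∏ i, s i) := by
  classical
  -- Sums over the cubes `B N` factor exactly, and the cubes exhaust all multi-indices.
  let B : ℕ → Finset (ι → ℕ) := fun N => Fintype.piFinset fun _ => Finset.range N
  have hB : ∀ N, ∑ α ∈ B N, ∏ i, f i (α i) = ∏ i, ∑ n ∈ Finset.range N, f i n := fun N =>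
    (Finset.prod_univ_sum _ _).symm
  have hmono : Monotone B := fun M N h => Fintype.piFinset_subset _ _ fun _ =>
    Finset.range_mono h
  have hB' : Tendsto B atTop atTop := by
    refine tendsto_atTop_finset_of_monotone hmono fun α => ⟨∑ i, α i + 1, ?_⟩
    simp only [B, Fintype.mem_piFinset, Finset.mem_range]
    intro i
    have := Finset.single_le_sum (f := α) (fun _ _ => Nat.zero_le _) (Finset.mem_univ i)
    omega
  have hsum : Summable fun α : ι → ℕ => ∏ i, f i (α i) := by
    refine summable_of_sum_le (c := ∏ i, s i)
      (fun α => Finset.prod_nonneg fun i _ => hf i _) fun u => ?_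
    obtain ⟨N, hN⟩ := (hB'.eventually_ge_atTop u).exists
    calc ∑ α ∈ u, ∏ i, f i (α i) ≤ ∑ α ∈ B N, ∏ i, f i (α i) :=
          Finset.sum_le_sum_of_subset_of_nonneg hN
            fun α _ _ => Finset.prod_nonneg fun i _ => hf i _
      _ = ∏ i, ∑ n ∈ Finset.range N, f i n := hB N
      _ ≤ ∏ i, s i := Finset.prod_le_prod (fun i _ => Finset.sum_nonneg fun n _ => hf i n)
          fun i _ => sum_le_hasSum _ (fun n _ => hf i n) (hs i)
  have h1 := hsum.hasSum.comp hB'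
  have h2 : Tendsto (fun N => ∑ α ∈ B N, ∏ i, f i (α i)) atTop (𝓝 (∏ i, s i)) := by
    simp_rw [hB]
    exact tendsto_finsetProd _ fun i _ => (hs i).tendsto_sum_nat
  rw [← tendsto_nhds_unique h1 h2]
  exact hsum.hasSum

lemma summable_pow_degree {d : ℕ} {ρ : ℝ} (h0 : 0 ≤ ρ) (h1 : ρ < 1) :
    Summable fun α : Idx d → ℕ => ρ ^ degree α := by
  have h := hasSum_prod_pi (ι := Idx d) (f := fun _ n => ρ ^ n) (fun _ n => pow_nonneg h0 n)
    fun _ => hasSum_geometric_of_lt_one h0 h1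
  refine h.summable.congr fun α => ?_
  rw [degree, Finset.prod_pow_eq_pow_sum]

lemma hermiteFun_eq {d : ℕ} (α : Idx d → ℕ) (x : Vec d) :
    hermiteFun α x = ∏ i, ((He (α i) (x i) : ℂ) / (√((α i).factorial : ℝ) : ℝ)) := by
  simp [hermiteFun, He]

lemma conj_hermiteFun {d : ℕ} (α : Idx d → ℕ) (x : Vec d) :
    (starRingEnd ℂ) (hermiteFun α x) = hermiteFun α x := by
  rw [hermiteFun, map_prod]
  exact Finset.prod_congr rfl fun i _ => Complex.conj_ofReal _

lemma chaosCoeff_eq_integral {d : ℕ} (α : Idx d → ℕ) (φ : L2 d) :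
    chaosCoeff α φ = ∫ x, hermiteFun α x * φ x ∂(gaussian d) := by
  rw [chaosCoeff, L2.inner_def]
  refine integral_congr_ae ?_
  filter_upwards [(memLp_hermiteFun α).coeFn_toLp] with x hx
  rw [hermiteLp, hx, RCLike.inner_apply, conj_hermiteFun, mul_comm]

lemma integral_gaussian_prod {d : ℕ} (f : Idx d → ℝ → ℂ) :
    ∫ x : Vec d, ∏ i, f i (x i) ∂(gaussian d) = ∏ i, ∫ t, f i t ∂(gaussianReal 0 1) :=
  integral_fintype_prod_eq_prod f

lemma orthonormal_hermiteLp (d : ℕ) : Orthonormal ℂ (hermiteLp (d := d)) := by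
  classical
  rw [orthonormal_iff_ite]
  intro α β
  have h : inner ℂ (hermiteLp α) (hermiteLp β) = chaosCoeff α (hermiteLp β) := rfl
  rw [h, chaosCoeff_eq_integral]
  have h1 : ∫ x, hermiteFun α x * hermiteLp β x ∂(gaussian d) =
      ∏ i, ∫ t, ((He (α i) t : ℂ) / (√((α i).factorial : ℝ) : ℝ)) *
        ((He (β i) t : ℂ) / (√((β i).factorial : ℝ) : ℝ)) ∂(gaussianReal 0 1) := by
    rw [← integral_gaussian_prod fun (i : Idx d) (t : ℝ) =>
      ((He (α i) t : ℂ) / (√((α i).factorial : ℝ) : ℝ)) *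
        ((He (β i) t : ℂ) / (√((β i).factorial : ℝ) : ℝ))]
    refine integral_congr_ae ?_
    filter_upwards [(memLp_hermiteFun β).coeFn_toLp] with x hx
    rw [hermiteLp, hx, hermiteFun_eq, hermiteFun_eq, Finset.prod_mul_distrib]
  have h2 (m n : ℕ) : ∫ t, ((He m t : ℂ) / (√(m.factorial : ℝ) : ℝ)) *
      ((He n t : ℂ) / (√(n.factorial : ℝ) : ℝ)) ∂(gaussianReal 0 1) = if m = n then 1 else 0 := by
    have e (t : ℝ) : ((He m t : ℂ) / (√(m.factorial : ℝ) : ℝ)) *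
        ((He n t : ℂ) / (√(n.factorial : ℝ) : ℝ)) =
        ((√(m.factorial : ℝ) * √(n.factorial : ℝ) : ℝ) : ℂ)⁻¹ * (He m t * He n t) := by
      push_cast
      field_simp
    simp_rw [e]
    rw [integral_const_mul, integral_He_mul_He]
    split_ifs with hmn
    · subst hmn
      rw [Real.mul_self_sqrt (by positivity), Complex.ofReal_natCast]
      exact inv_mul_cancel₀ (by exact_mod_cast m.factorial_ne_zero)
    · simp
  rw [h1]
  simp_rw [h2]
  split_ifs with hαβ
  · simp [hαβ]
  · obtain ⟨i, hi⟩ := Function.ne_iff.1 hαβ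
    exact Finset.prod_eq_zero (Finset.mem_univ i) (if_neg hi)

lemma norm_cexp_I_mul (r : ℝ) : ‖Complex.exp (Complex.I * r)‖ = 1 := by
  rw [mul_comm, Complex.norm_exp_ofReal_mul_I]

lemma memLp_charFun {d : ℕ} (F : Vec d) :
    MemLp (fun x : Vec d => Complex.exp (Complex.I * ((x ⬝ᵥ F : ℝ) : ℂ))) 2 (gaussian d) := by
  refine MemLp.of_bound (Continuous.aestronglyMeasurable ?_) 1
    (Eventually.of_forall fun x => (norm_cexp_I_mul _).le)
  unfold dotProduct
  fun_prop

/-- The plane wave `exp (i ⟨·, F⟩)` as an element of `L²(μ_{1,d})`. -/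
def waveLp {d : ℕ} (F : Vec d) : L2 d := (memLp_charFun F).toLp _

lemma wave_eq_prod {d : ℕ} (F x : Vec d) :
    Complex.exp (Complex.I * ((x ⬝ᵥ F : ℝ) : ℂ)) =
      ∏ i, Complex.exp (Complex.I * F i * x i) := by
  rw [← Complex.exp_sum, dotProduct]
  push_cast
  rw [Finset.mul_sum]
  congr 1
  exact Finset.sum_congr rfl fun i _ => by ring

lemma chaosCoeff_waveLp {d : ℕ} (α : Idx d → ℕ) (F : Vec d) :
    chaosCoeff α (waveLp F) = ∏ i, ((Complex.I * F i) ^ α i *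
      Complex.exp (-(F i ^ 2 / 2)) / (√((α i).factorial : ℝ) : ℝ)) := by
  rw [chaosCoeff_eq_integral]
  have h1 : ∫ x, hermiteFun α x * waveLp F x ∂(gaussian d) =
      ∏ i, ∫ t, ((He (α i) t : ℂ) * Complex.exp (Complex.I * F i * t)) /
        (√((α i).factorial : ℝ) : ℝ) ∂(gaussianReal 0 1) := by
    rw [← integral_gaussian_prod fun (i : Idx d) (t : ℝ) =>
      ((He (α i) t : ℂ) * Complex.exp (Complex.I * F i * t)) / (√((α i).factorial : ℝ) : ℝ)]
    refine integral_congr_ae ?_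
    filter_upwards [(memLp_charFun F).coeFn_toLp] with x hx
    rw [waveLp, hx, hermiteFun_eq, wave_eq_prod, ← Finset.prod_mul_distrib]
    exact Finset.prod_congr rfl fun i _ => by ring
  rw [h1]
  refine Finset.prod_congr rfl fun i _ => ?_
  rw [integral_div, integral_He_mul_cexp]

lemma norm_sq_chaosCoeff_waveLp {d : ℕ} (α : Idx d → ℕ) (F : Vec d) :
    ‖chaosCoeff α (waveLp F)‖ ^ 2 =
      ∏ i, ((F i ^ 2) ^ α i / (α i).factorial * Real.exp (-(F i ^ 2))) := by
  rw [chaosCoeff_waveLp, norm_prod, ← Finset.prod_pow]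
  refine Finset.prod_congr rfl fun i _ => ?_
  have h : Complex.exp (-((F i : ℂ) ^ 2 / 2)) = (Real.exp (-(F i ^ 2 / 2)) : ℝ) := by
    push_cast; rfl
  have h2 : Real.exp (-(F i ^ 2)) = Real.exp (-(F i ^ 2 / 2)) ^ 2 := by
    rw [← Real.exp_nat_mul]; push_cast; ring_nf
  rw [h, norm_div, norm_mul, norm_pow, norm_mul, Complex.norm_I, one_mul, Complex.norm_real,
    Complex.norm_real, Complex.norm_real, Real.norm_of_nonneg (Real.exp_pos _).le,
    Real.norm_of_nonneg (Real.sqrt_nonneg _), div_pow, Real.sq_sqrt (by positivity), mul_pow,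
    ← pow_mul, mul_comm (α i) 2, pow_mul, Real.norm_eq_abs, sq_abs, h2]
  ring

/-- Finiteness for every `q` makes plane waves test functions; at `q = 0` the sum is 1, which is
Parseval's identity for a wave. -/
lemma hasSum_norm_sq_chaosCoeff_waveLp {d : ℕ} (q : ℕ) (F : Vec d) :
    HasSum (fun α : Idx d → ℕ => (2 : ℝ) ^ (q * degree α) * ‖chaosCoeff α (waveLp F)‖ ^ 2)
      (∏ i, (Real.exp (2 ^ q * F i ^ 2) * Real.exp (-(F i ^ 2)))) := by
  have h := hasSum_prod_pi (ι := Idx d)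
    (f := fun i n => (2 ^ q * F i ^ 2) ^ n / n.factorial * Real.exp (-(F i ^ 2)))
    (fun i n => by positivity) fun i => by
      have := (NormedSpace.expSeries_div_hasSum_exp (2 ^ q * F i ^ 2)).mul_right
        (Real.exp (-(F i ^ 2)))
      rwa [← Real.exp_eq_exp_ℝ] at this
  refine h.congr_fun fun α => ?_
  rw [norm_sq_chaosCoeff_waveLp, degree, Finset.mul_sum, ← Finset.prod_pow_eq_pow_sum,
    ← Finset.prod_mul_distrib]
  refine Finset.prod_congr rfl fun i _ => ?_
  rw [mul_pow, pow_mul]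
  ring

lemma norm_waveLp {d : ℕ} (F : Vec d) : ‖waveLp F‖ = 1 := by
  have h := @inner_self_eq_norm_sq_to_K ℂ _ _ _ _ (waveLp F)
  rw [L2.inner_def] at h
  have h1 : ∫ x, inner ℂ (waveLp F x) (waveLp F x) ∂(gaussian d) = 1 := by
    have : ∫ x, inner ℂ (waveLp F x) (waveLp F x) ∂(gaussian d) = ∫ _, (1 : ℂ) ∂(gaussian d) := by
      refine integral_congr_ae ?_
      filter_upwards [(memLp_charFun F).coeFn_toLp] with x hx
      rw [waveLp, hx, inner_self_eq_norm_sq_to_K, norm_cexp_I_mul]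
      simp
    simpa using this
  rw [h1] at h
  have h2 : ‖waveLp F‖ ^ 2 = 1 := Complex.ofReal_injective (by push_cast; exact h.symm)
  nlinarith [norm_nonneg (waveLp F)]

/-- A vector for which Parseval's identity holds is orthogonal to everything that is orthogonal
to the orthonormal family. -/
lemma inner_eq_zero_of_parseval {ι E : Type*} [NormedAddCommGroup E] [InnerProductSpace ℂ E]
    {v : ι → E} (hv : Orthonormal ℂ v) {e φ : E}
    (he : HasSum (fun i => ‖inner ℂ (v i) e‖ ^ 2) (‖e‖ ^ 2))
    (hφ : ∀ i, inner ℂ (v i) φ = 0) : inner ℂ e φ = 0 := by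
  by_contra hz
  set z : ℂ := inner ℂ e φ with hzdef
  have hz' : 0 < ‖z‖ ^ 2 := by positivity
  -- Subtracting `s z̄ φ` from `e` leaves all coefficients unchanged but changes the squared norm by
  -- `-2s|z|² + s²|z|²‖φ‖²`. This is negative as `s‖φ‖² < 1`, contradicting Bessel's inequality.
  set s : ℝ := 1 / (‖φ‖ ^ 2 + 1) with hs
  have hs0 : 0 < s := by positivity
  have hs1 : s * ‖φ‖ ^ 2 < 1 := by
    rw [hs, one_div, inv_mul_lt_one₀ (by positivity)]
    linarith
  have h1 := hv.tsum_inner_products_le (e - ((s : ℂ) * (starRingEnd ℂ) z) • φ)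
  simp only [inner_sub_right, inner_smul_right, hφ, mul_zero, sub_zero, he.tsum_eq] at h1
  rw [@norm_sub_sq ℂ, inner_smul_right, ← hzdef, norm_smul, norm_mul, RCLike.norm_conj,
    Complex.norm_real, Real.norm_of_nonneg hs0.le, mul_assoc, Complex.conj_mul'] at h1
  have h2 : RCLike.re ((s : ℂ) * (‖z‖ : ℂ) ^ 2) = s * ‖z‖ ^ 2 := by
    rw [← Complex.ofReal_pow, ← Complex.ofReal_mul]
    exact Complex.ofReal_re _
  rw [h2] at h1
  have h3 : s * ‖z‖ ^ 2 * (s * ‖φ‖ ^ 2) < s * ‖z‖ ^ 2 * 1 := by gcongr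
  nlinarith [mul_pos hs0 hz']

/-- Injectivity of the Fourier transform for real densities with respect to a finite measure. -/
lemma ae_eq_zero_of_integral_wave_real {d : ℕ} {μ : Measure (Vec d)} [IsFiniteMeasure μ]
    {f : Vec d → ℝ} (hf : Integrable f μ)
    (h : ∀ F : Vec d, ∫ x, (f x : ℂ) * Complex.exp (Complex.I * ((x ⬝ᵥ F : ℝ) : ℂ)) ∂μ = 0) :
    f =ᵐ[μ] 0 := by
  have hm : AEMeasurable (fun x => ENNReal.ofReal (f x)) μ := hf.aemeasurable.ennreal_ofReal
  have hm' : AEMeasurable (fun x => ENNReal.ofReal (-f x)) μ := hf.neg.aemeasurable.ennreal_ofReal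
  have hfin : ∫⁻ x, ENNReal.ofReal (f x) ∂μ ≠ ∞ := hf.lintegral_lt_top.ne
  have hfin' : ∫⁻ x, ENNReal.ofReal (-f x) ∂μ ≠ ∞ := hf.neg.lintegral_lt_top.ne
  have := isFiniteMeasure_withDensity hfin
  have := isFiniteMeasure_withDensity hfin'
  -- The positive and negative parts of `f` define finite measures with equal characteristic
  -- functions. Equality of the measures makes the two parts agree a.e., and as one of them is zero
  -- at every point, both vanish.
  have key : μ.withDensity (fun x => ENNReal.ofReal (f x)) =
      μ.withDensity (fun x => ENNReal.ofReal (-f x)) := by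
    refine Measure.ext_of_charFunDual (funext fun L => ?_)
    rw [charFunDual_apply, charFunDual_apply,
      integral_withDensity_eq_integral_toReal_smul₀ hm (by simp),
      integral_withDensity_eq_integral_toReal_smul₀ hm' (by simp), ← sub_eq_zero]
    have hL (x : Vec d) : L x = x ⬝ᵥ fun i => L fun j => if i = j then 1 else 0 :=
      LinearMap.pi_apply_eq_sum_univ L.toLinearMap x
    have hb (g : Vec d → ℝ) (hg : Integrable g μ) :
        Integrable (fun x => g x • Complex.exp (L x * Complex.I)) μ := by
      refine hg.ofReal.mul_bdd (c := 1) (Continuous.aestronglyMeasurable (by fun_prop))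
        (Eventually.of_forall fun x => ?_)
      rw [Complex.norm_exp_ofReal_mul_I]
    have e1 : (fun x => (ENNReal.ofReal (f x)).toReal) = fun x => max (f x) 0 := by
      funext x; exact ENNReal.toReal_ofReal'
    have e2 : (fun x => (ENNReal.ofReal (-f x)).toReal) = fun x => max (-f x) 0 := by
      funext x; exact ENNReal.toReal_ofReal'
    have i1 : Integrable (fun x => (ENNReal.ofReal (f x)).toReal) μ := by
      rw [e1]; exact hf.pos_part
    have i2 : Integrable (fun x => (ENNReal.ofReal (-f x)).toReal) μ := by
      rw [e2]; exact hf.neg_part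
    rw [← integral_sub (hb _ i1) (hb _ i2), ← h fun i => L fun j => if i = j then 1 else 0]
    congr 1
    funext x
    rw [congrFun e1 x, congrFun e2 x, ← sub_smul, max_zero_sub_max_neg_zero_eq_self, ← hL,
      mul_comm Complex.I, Complex.real_smul]
  have h2 := (withDensity_eq_iff hm hm' hfin).1 key
  filter_upwards [h2] with x hx
  rcases le_total 0 (f x) with h0 | h0
  · rw [ENNReal.ofReal_of_nonpos (show -f x ≤ 0 by linarith), ENNReal.ofReal_eq_zero] at hx
    exact le_antisymm hx h0
  · rw [ENNReal.ofReal_of_nonpos h0, eq_comm, ENNReal.ofReal_eq_zero] at hx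
    exact le_antisymm h0 (neg_nonpos.1 hx)

/-- Injectivity of the Fourier transform for densities with respect to a finite measure. -/
lemma ae_eq_zero_of_integral_wave {d : ℕ} {μ : Measure (Vec d)} [IsFiniteMeasure μ]
    {f : Vec d → ℂ} (hf : Integrable f μ)
    (h : ∀ F : Vec d, ∫ x, f x * Complex.exp (Complex.I * ((x ⬝ᵥ F : ℝ) : ℂ)) ∂μ = 0) :
    f =ᵐ[μ] 0 := by
  have hb (g : Vec d → ℂ) (hg : Integrable g μ) (F : Vec d) :
      Integrable (fun x => g x * Complex.exp (Complex.I * ((x ⬝ᵥ F : ℝ) : ℂ))) μ := by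
    refine hg.mul_bdd (c := 1) (Continuous.aestronglyMeasurable (by unfold dotProduct; fun_prop))
      (Eventually.of_forall fun x => (norm_cexp_I_mul _).le)
  have hfc : Integrable (fun x => (starRingEnd ℂ) (f x)) μ :=
    (LinearIsometryEquiv.integrable_comp_iff Complex.conjLIE).2 hf
  -- Conjugating the hypothesis at `-F` shows that the conjugate of `f` also has zero transform,
  -- which separates real and imaginary parts.
  have hc (F : Vec d) :
      ∫ x, (starRingEnd ℂ) (f x) * Complex.exp (Complex.I * ((x ⬝ᵥ F : ℝ) : ℂ)) ∂μ = 0 := by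
    have h1 := congrArg (starRingEnd ℂ) (h (-F))
    rw [← integral_conj, map_zero] at h1
    rw [← h1]
    congr 1
    funext x
    rw [map_mul, ← Complex.exp_conj, map_mul, Complex.conj_I, Complex.conj_ofReal]
    simp
  have hre : (fun x => (f x).re) =ᵐ[μ] 0 := by
    refine ae_eq_zero_of_integral_wave_real hf.re fun F => ?_
    have := (integral_add (hb _ hf F) (hb _ hfc F)).trans (by rw [h, hc, add_zero])
    rw [← mul_zero (1 / 2 : ℂ), ← this, ← integral_const_mul]
    congr 1
    funext x
    rw [Complex.re_eq_add_conj]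
    ring
  have him : (fun x => (f x).im) =ᵐ[μ] 0 := by
    refine ae_eq_zero_of_integral_wave_real hf.im fun F => ?_
    have := (integral_sub (hb _ hf F) (hb _ hfc F)).trans (by rw [h, hc, sub_zero])
    rw [← mul_zero (1 / (2 * Complex.I) : ℂ), ← this, ← integral_const_mul]
    congr 1
    funext x
    rw [Complex.im_eq_sub_conj]
    ring
  filter_upwards [hre, him] with x h1 h2
  exact Complex.ext h1 h2

/-- Plane waves satisfy Parseval's identity, so `φ` is orthogonal to each of them, and its Fourier
transform vanishes. -/
lemma eq_zero_of_chaosCoeff_eq_zero {d : ℕ} {φ : L2 d} (h : ∀ α, chaosCoeff α φ = 0) : φ = 0 := by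
  have hw (F : Vec d) : inner ℂ (waveLp F) φ = 0 := by
    refine inner_eq_zero_of_parseval (orthonormal_hermiteLp d) ?_ h
    have h1 := hasSum_norm_sq_chaosCoeff_waveLp 0 F
    have h2 : (∏ i, (Real.exp (2 ^ 0 * F i ^ 2) * Real.exp (-(F i ^ 2)))) = 1 := by
      refine Finset.prod_eq_one fun i _ => ?_
      rw [← Real.exp_add]
      simp
    rw [h2] at h1
    rw [norm_waveLp, one_pow]
    simpa [chaosCoeff] using h1
  have hφ : Integrable φ (gaussian d) := (Lp.memLp φ).integrable (by norm_num)
  rw [Lp.eq_zero_iff_ae_eq_zero]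
  refine ae_eq_zero_of_integral_wave hφ fun F => ?_
  rw [← hw (-F), L2.inner_def]
  refine integral_congr_ae ?_
  filter_upwards [(memLp_charFun (-F)).coeFn_toLp] with x hx
  rw [waveLp, hx, RCLike.inner_apply, ← Complex.exp_conj, map_mul, Complex.conj_I,
    Complex.conj_ofReal]
  simp

/-- The chaos expansion in `L²(μ_{1,d})`. -/
lemma hasSum_chaosCoeff_smul_hermiteLp {d : ℕ} (φ : L2 d) :
    HasSum (fun α => chaosCoeff α φ • hermiteLp α) φ := by
  have hbot : (Submodule.span ℂ (Set.range (hermiteLp (d := d))))ᗮ = ⊥ := by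
    rw [Submodule.eq_bot_iff]
    intro ψ hψ
    exact eq_zero_of_chaosCoeff_eq_zero fun α =>
      (Submodule.mem_orthogonal _ _).1 hψ _ (Submodule.subset_span ⟨α, rfl⟩)
  have h := (HilbertBasis.mkOfOrthogonalEqBot (orthonormal_hermiteLp d) hbot).hasSum_repr φ
  simpa [HilbertBasis.repr_apply_apply, chaosCoeff] using h

/-! ### The regularized kernel: factorization, coefficients and plane waves -/

lemma regularized_eq_prod {d : ℕ} (ε : ℝ) (x : Vec d) :
    regularized d ε x = ∏ μ : Fin d, (2 * (Real.pi : ℂ) *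
      Complex.exp ((1 - ε) / 2 * (x (Sum.inl μ) ^ 2 + x (Sum.inr μ) ^ 2) +
        Complex.I * (x (Sum.inl μ) * x (Sum.inr μ)))) := by
  rw [Finset.prod_mul_distrib, Finset.prod_const, Finset.card_univ, Fintype.card_fin,
    ← Complex.exp_sum, regularized]
  congr 2
  have h : (Matrix.fromBlocks 0 1 1 0 : Matrix (Idx d) (Idx d) ℂ) *ᵥ (fun i => (x i : ℂ)) =
      Sum.elim (fun μ => (x (Sum.inr μ) : ℂ)) (fun μ => (x (Sum.inl μ) : ℂ)) := by
    rw [Matrix.fromBlocks_mulVec]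
    simp [Function.comp_def]
  rw [K, Matrix.neg_mulVec, Matrix.add_mulVec, Matrix.smul_mulVec, Matrix.smul_mulVec, h,
    Matrix.one_mulVec]
  simp only [dotProduct, Fintype.sum_sum_type, Pi.neg_apply, Pi.add_apply, Pi.smul_apply,
    smul_eq_mul, Sum.elim_inl, Sum.elim_inr]
  rw [← Finset.sum_add_distrib, Finset.mul_sum]
  refine Finset.sum_congr rfl fun μ _ => ?_
  push_cast
  ring

lemma continuous_regularized (d : ℕ) (ε : ℝ) : Continuous (regularized d ε) := by
  have h : regularized d ε = fun x => _ := funext fun x => regularized_eq_prod ε x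
  rw [h]
  fun_prop

lemma norm_regularized {d : ℕ} (ε : ℝ) (x : Vec d) :
    ‖regularized d ε x‖ = (2 * Real.pi) ^ d * ∏ i, Real.exp ((1 - ε) / 2 * x i ^ 2) := by
  rw [regularized_eq_prod, norm_prod, Fintype.prod_sum_type, ← Finset.prod_mul_distrib]
  have h : (2 * Real.pi) ^ d = ∏ _μ : Fin d, 2 * Real.pi := by simp
  rw [h, ← Finset.prod_mul_distrib]
  refine Finset.prod_congr rfl fun μ _ => ?_
  rw [norm_mul, Complex.norm_exp, ← Real.exp_add]
  congr 2
  · simp [Real.pi_pos.le]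
  · rw [← Complex.ofReal_mul, Complex.add_re, Complex.re_mul_ofReal, Complex.I_re, zero_mul,
      add_zero, ← Complex.ofReal_re ((1 - ε) / 2 * x (Sum.inl μ) ^ 2 +
        (1 - ε) / 2 * x (Sum.inr μ) ^ 2)]
    push_cast
    ring_nf

lemma gaussianReal_prod_eq :
    (gaussianReal 0 1).prod (gaussianReal 0 1) =
      (volume : Measure (ℝ × ℝ)).withDensity
        fun z => gaussianPDF 0 1 z.1 * gaussianPDF 0 1 z.2 := by
  rw [gaussianReal_of_var_ne_zero _ one_ne_zero, Measure.volume_eq_prod,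
    prod_withDensity (measurable_gaussianPDF 0 1) (measurable_gaussianPDF 0 1)]

lemma gaussianPDFReal_zero_one (x : ℝ) :
    gaussianPDFReal 0 1 x = (√(2 * Real.pi))⁻¹ * Real.exp (-(1 / 2) * x ^ 2) := by
  simp only [gaussianPDFReal]
  congr 2
  · simp
  · simp
    ring

/-- The regularized kernel of one coordinate pair turns the Gaussian measure into the oscillatory
Gaussian density. -/
lemma integral_gaussian_pair (ε : ℝ) (p q : ℝ → ℂ) :
    ∫ z : ℝ × ℝ, (2 * (Real.pi : ℂ) * Complex.exp ((1 - ε) / 2 * (z.1 ^ 2 + z.2 ^ 2) +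
        Complex.I * (z.1 * z.2))) * (p z.1 * q z.2)
        ∂((gaussianReal 0 1).prod (gaussianReal 0 1)) = regPair ε p q := by
  rw [gaussianReal_prod_eq, integral_withDensity_eq_integral_toReal_smul
    (by fun_prop)
    (Eventually.of_forall fun z => ENNReal.mul_lt_top gaussianPDF_lt_top
      gaussianPDF_lt_top), regPair]
  congr 1
  funext z
  rw [ENNReal.toReal_mul, gaussianPDF_def, ENNReal.toReal_ofReal (gaussianPDFReal_nonneg _ _ _),
    ENNReal.toReal_ofReal (gaussianPDFReal_nonneg _ _ _), gaussianPDFReal_zero_one,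
    gaussianPDFReal_zero_one, Complex.real_smul, pairIntegrand]
  have h1 : (√(2 * Real.pi))⁻¹ * Real.exp (-(1 / 2) * z.1 ^ 2) *
      ((√(2 * Real.pi))⁻¹ * Real.exp (-(1 / 2) * z.2 ^ 2)) =
      (2 * Real.pi)⁻¹ * (Real.exp (-(1 / 2) * z.1 ^ 2) * Real.exp (-(1 / 2) * z.2 ^ 2)) := by
    rw [mul_mul_mul_comm, ← mul_inv, Real.mul_self_sqrt (by positivity)]
  have hpi : (2 * (Real.pi : ℂ)) ≠ 0 := by
    simp [Real.pi_ne_zero]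
  have h2 : Complex.exp (-(1 / 2) * z.1 ^ 2) * Complex.exp (-(1 / 2) * z.2 ^ 2) *
      Complex.exp ((1 - ε) / 2 * (z.1 ^ 2 + z.2 ^ 2) + Complex.I * (z.1 * z.2)) =
      Complex.exp (-(ε / 2) * z.1 ^ 2) * Complex.exp (-(ε / 2) * z.2 ^ 2) *
        Complex.exp (Complex.I * (z.1 * z.2)) := by
    simp only [← Complex.exp_add]
    ring_nf
  rw [h1]
  push_cast
  calc _ = (2 * (Real.pi : ℂ))⁻¹ * (2 * (Real.pi : ℂ)) * (Complex.exp (-(1 / 2) * z.1 ^ 2) *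
          Complex.exp (-(1 / 2) * z.2 ^ 2) * Complex.exp ((1 - ε) / 2 * (z.1 ^ 2 + z.2 ^ 2) +
            Complex.I * (z.1 * z.2))) * (p z.1 * q z.2) := by ring
    _ = _ := by rw [h2, inv_mul_cancel₀ hpi]; ring

/-- The `2d` coordinates are regrouped into `d` independent pairs by measure-preserving
equivalences; the kernel couples only `a_μ` with `b_μ`. -/
lemma integral_gaussian_prod_pair {d : ℕ} (g : Fin d → ℝ × ℝ → ℂ) :
    ∫ x : Vec d, ∏ μ, g μ (x (Sum.inl μ), x (Sum.inr μ)) ∂(gaussian d) =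
      ∏ μ, ∫ z, g μ z ∂((gaussianReal 0 1).prod (gaussianReal 0 1)) := by
  have h1 := (measurePreserving_sumPiEquivProdPi (X := fun _ : Idx d => ℝ)
    (fun _ => gaussianReal 0 1)).integral_comp'
    (fun y : (Fin d → ℝ) × (Fin d → ℝ) => ∏ μ, g μ (y.1 μ, y.2 μ))
  have h2 := (measurePreserving_arrowProdEquivProdArrow ℝ ℝ (Fin d)
    (fun _ => gaussianReal 0 1) (fun _ => gaussianReal 0 1)).integral_comp'
    (fun y : (Fin d → ℝ) × (Fin d → ℝ) => ∏ μ, g μ (y.1 μ, y.2 μ))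
  have h3 := integral_fintype_prod_eq_prod
    (μ := fun _ : Fin d => (gaussianReal 0 1).prod (gaussianReal 0 1)) g
  exact h1.trans (h2.symm.trans h3)

lemma integral_regularized_mul_prod {d : ℕ} (ε : ℝ) (p : Idx d → ℝ → ℂ) :
    ∫ x, regularized d ε x * ∏ i, p i (x i) ∂(gaussian d) =
      ∏ μ : Fin d, regPair ε (p (Sum.inl μ)) (p (Sum.inr μ)) := by
  simp_rw [← integral_gaussian_pair]
  rw [← integral_gaussian_prod_pair fun μ z => (2 * (Real.pi : ℂ) *
    Complex.exp ((1 - ε) / 2 * (z.1 ^ 2 + z.2 ^ 2) + Complex.I * (z.1 * z.2))) *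
      (p (Sum.inl μ) z.1 * p (Sum.inr μ) z.2)]
  congr 1
  funext x
  rw [regularized_eq_prod, Fintype.prod_sum_type, ← Finset.prod_mul_distrib,
    ← Finset.prod_mul_distrib]

/-- The chaos coefficients of the regularized distributions. -/
def regCoeff {d : ℕ} (ε : ℝ) (α : Idx d → ℕ) : ℂ :=
  ∏ μ : Fin d, (hermitePair ε (α (Sum.inl μ)) (α (Sum.inr μ)) /
    ((√((α (Sum.inl μ)).factorial : ℝ) * √((α (Sum.inr μ)).factorial : ℝ) : ℝ) : ℂ))

lemma integral_regularized_mul_hermiteFun {d : ℕ} (ε : ℝ) (α : Idx d → ℕ) :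
    ∫ x, regularized d ε x * hermiteFun α x ∂(gaussian d) = regCoeff ε α := by
  simp_rw [hermiteFun_eq]
  rw [integral_regularized_mul_prod ε fun i t =>
    (He (α i) t : ℂ) / (√((α i).factorial : ℝ) : ℝ), regCoeff]
  refine Finset.prod_congr rfl fun μ _ => ?_
  simp_rw [div_eq_inv_mul]
  rw [regPair_const_mul_left, regPair_comm, regPair_const_mul_left, regPair_comm, hermitePair]
  push_cast
  rw [mul_inv]
  ring

lemma norm_regCoeff_le {d : ℕ} {ε : ℝ} (hε : 0 < ε) (α : Idx d → ℕ) :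
    ‖regCoeff ε α‖ ≤ (2 * Real.pi) ^ d * 2 ^ degree α := by
  rw [regCoeff, norm_prod]
  have h : (2 * Real.pi) ^ d * 2 ^ degree α =
      ∏ μ : Fin d, (2 * Real.pi * 2 ^ (α (Sum.inl μ) + α (Sum.inr μ))) := by
    rw [Finset.prod_mul_distrib, Finset.prod_pow_eq_pow_sum, degree, Fintype.sum_sum_type,
      Finset.sum_add_distrib]
    simp
  rw [h]
  refine Finset.prod_le_prod (fun μ _ => norm_nonneg _) fun μ _ => ?_
  rw [norm_div, Complex.norm_real, Real.norm_of_nonneg (by positivity), div_le_iff₀]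
  · exact norm_hermitePair_le hε _ _
  · exact mul_pos (Real.sqrt_pos.2 (by exact_mod_cast Nat.factorial_pos _))
      (Real.sqrt_pos.2 (by exact_mod_cast Nat.factorial_pos _))

lemma exists_tendsto_regCoeff {d : ℕ} (α : Idx d → ℕ) :
    ∃ l : ℂ, Tendsto (fun ε => regCoeff ε α) (𝓝[>] 0) (𝓝 l) := by
  choose l hl using exists_tendsto_hermitePair
  exact ⟨_, tendsto_finsetProd _ fun μ _ => (hl _ _).div_const _⟩

lemma integral_regularized_mul_wave {d : ℕ} {ε : ℝ} (hε : 0 < ε) (F : Vec d) :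
    ∫ x, regularized d ε x * Complex.exp (Complex.I * ((x ⬝ᵥ F : ℝ) : ℂ)) ∂(gaussian d) =
      ∏ μ : Fin d, (((2 * Real.pi / √(ε ^ 2 + 1) : ℝ) : ℂ) *
        Complex.exp (-(ε * F (Sum.inl μ) ^ 2 +
          2 * Complex.I * F (Sum.inl μ) * F (Sum.inr μ) + ε * F (Sum.inr μ) ^ 2) /
          (2 * (ε ^ 2 + 1)))) := by
  simp_rw [wave_eq_prod]
  rw [integral_regularized_mul_prod ε fun i t => Complex.exp (Complex.I * F i * t)]
  exact Finset.prod_congr rfl fun μ _ => regPair_cexp hε _ _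

/-- The closed form valid for `ε > 0` is continuous on all of `ℝ`, so the limit is its value at 0.
-/
lemma tendsto_integral_regularized_mul_wave {d : ℕ} (F : Vec d) :
    Tendsto (fun ε => ∫ x, regularized d ε x *
      Complex.exp (Complex.I * ((x ⬝ᵥ F : ℝ) : ℂ)) ∂(gaussian d)) (𝓝[>] 0)
      (𝓝 ((2 * (Real.pi : ℂ)) ^ d * Complex.exp (-Complex.I *
        ∑ μ : Fin d, (F (Sum.inl μ) : ℂ) * (F (Sum.inr μ) : ℂ)))) := by
  have hpos : ∀ᶠ ε : ℝ in 𝓝[>] 0, 0 < ε := self_mem_nhdsWithin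
  refine Tendsto.congr' (hpos.mono fun ε hε => (integral_regularized_mul_wave hε F).symm) ?_
  have hc : Continuous fun ε : ℝ => ∏ μ : Fin d, (((2 * Real.pi / √(ε ^ 2 + 1) : ℝ) : ℂ) *
        Complex.exp (-(ε * F (Sum.inl μ) ^ 2 +
          2 * Complex.I * F (Sum.inl μ) * F (Sum.inr μ) + ε * F (Sum.inr μ) ^ 2) /
          (2 * (ε ^ 2 + 1)))) := by
    refine continuous_finsetProd _ fun μ _ => Continuous.mul ?_ ?_
    · exact Complex.continuous_ofReal.comp (continuous_const.div (by fun_prop)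
        fun ε => (Real.sqrt_pos.2 (by positivity)).ne')
    · refine Complex.continuous_exp.comp (Continuous.div (by fun_prop) (by fun_prop) fun ε => ?_)
      have : (0 : ℝ) < 2 * (ε ^ 2 + 1) := by positivity
      exact_mod_cast this.ne'
  refine ((hc.tendsto 0).mono_left nhdsWithin_le_nhds).trans_eq ?_
  congr 1
  rw [Finset.mul_sum, Complex.exp_sum]
  have h : (2 * (Real.pi : ℂ)) ^ d = ∏ _μ : Fin d, 2 * (Real.pi : ℂ) := by simp
  rw [h, ← Finset.prod_mul_distrib]
  refine Finset.prod_congr rfl fun μ _ => ?_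
  congr 1
  · simp
  · congr 1
    push_cast
    ring

/-! ### Pointwise chaos expansion and termwise integration -/

lemma norm_hermiteFun_le {d : ℕ} {δ R : ℝ}
    (h : ∀ (n : ℕ) (x : ℝ), |He n x| ≤ √(n.factorial : ℝ) * R ^ n * Real.exp (δ * x ^ 2))
    (α : Idx d → ℕ) (x : Vec d) :
    ‖hermiteFun α x‖ ≤ R ^ degree α * ∏ i, Real.exp (δ * x i ^ 2) := by
  rw [hermiteFun_eq, norm_prod, degree, ← Finset.prod_pow_eq_pow_sum, ← Finset.prod_mul_distrib]
  refine Finset.prod_le_prod (fun i _ => norm_nonneg _) fun i _ => ?_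
  rw [norm_div, Complex.norm_real, Complex.norm_real, Real.norm_eq_abs,
    Real.norm_of_nonneg (Real.sqrt_nonneg _), div_le_iff₀
      (Real.sqrt_pos.2 (by exact_mod_cast Nat.factorial_pos _))]
  exact (h _ _).trans_eq (by ring)

/-- With `s = 2^(q|α|)` and `y = R^|α|`, the bound `c y ≤ s c² + y²/s` splits the series into the
norm `‖φ‖_q` and a geometric series, convergent once `R² < 2^q`. -/
lemma summable_norm_chaosCoeff_mul {d : ℕ} (φ : HidaTest d) (R : ℝ) (hR : 0 ≤ R) :
    Summable fun α => ‖chaosCoeff α φ.toL2‖ * R ^ degree α := by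
  obtain ⟨q, hq⟩ := pow_unbounded_of_one_lt (2 * R ^ 2) (one_lt_two (α := ℝ))
  have hρ : R ^ 2 / 2 ^ q < 1 := by
    rw [div_lt_one (by positivity)]
    nlinarith [sq_nonneg R]
  have h := (φ.2 q).add (summable_pow_degree (d := d) (ρ := R ^ 2 / 2 ^ q) (by positivity) hρ)
  refine Summable.of_nonneg_of_le (fun α => by positivity) (fun α => ?_) h
  set c := ‖chaosCoeff α φ.toL2‖
  have hc : ‖chaosCoeff α (φ.1 : L2 d)‖ = c := rfl
  rw [hc, div_pow, pow_right_comm, ← pow_mul 2 q]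
  set y := R ^ degree α
  have hs : (0 : ℝ) < 2 ^ (q * degree α) := by positivity
  set s : ℝ := 2 ^ (q * degree α)
  have h1 : s * c ^ 2 + y ^ 2 / s - c * y = (s * c - y / 2) ^ 2 / s + 3 / 4 * y ^ 2 / s := by
    field_simp; ring
  have h2 : 0 ≤ (s * c - y / 2) ^ 2 / s + 3 / 4 * y ^ 2 / s := by positivity
  linarith

/-- The chaos expansion of a test function converges pointwise. -/
lemma ae_hasSum_hermiteFun {d : ℕ} (φ : HidaTest d) :
    ∀ᵐ x ∂(gaussian d),
      HasSum (fun α => chaosCoeff α φ.toL2 * hermiteFun α x) (φ.toL2 x) := by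
  obtain ⟨R, hR, hH⟩ := exists_abs_He_le one_pos
  have hsum (x : Vec d) : Summable fun α => chaosCoeff α φ.toL2 * hermiteFun α x := by
    refine Summable.of_norm_bounded
      ((summable_norm_chaosCoeff_mul φ R (by linarith)).mul_right (∏ i, Real.exp (1 * x i ^ 2)))
      fun α => ?_
    rw [norm_mul, mul_assoc]
    gcongr
    exact norm_hermiteFun_le hH α x
  -- Convergence in `L²` gives a.e. convergence along some sequence of finite partial sums. As the
  -- series converges absolutely at every point, this determines its full sum.
  obtain ⟨ns, hns, hlim⟩ :=
    (tendstoInMeasure_of_tendsto_Lp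
      (hasSum_chaosCoeff_smul_hermiteLp φ.toL2)).exists_seq_tendsto_ae'
  have hpart : ∀ᵐ x ∂(gaussian d), ∀ n : ℕ,
      (∑ α ∈ ns n, chaosCoeff α φ.toL2 • hermiteLp α : L2 d) x =
        ∑ α ∈ ns n, chaosCoeff α φ.toL2 * hermiteFun α x := by
    rw [ae_all_iff]
    intro n
    have h1 : ∀ᵐ x ∂(gaussian d), ∀ α : Idx d → ℕ,
        (chaosCoeff α φ.toL2 • hermiteLp α : L2 d) x =
          chaosCoeff α φ.toL2 * hermiteFun α x := by
      rw [ae_all_iff]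
      intro α
      filter_upwards [Lp.coeFn_smul (chaosCoeff α φ.toL2) (hermiteLp α),
        (memLp_hermiteFun α).coeFn_toLp] with x hx hx'
      rw [hx, Pi.smul_apply, hermiteLp, hx', smul_eq_mul]
    filter_upwards [h1, Lp.coeFn_finsetSum (ns n)
      (fun α => (chaosCoeff α φ.toL2 • hermiteLp α : L2 d))] with x hx hx'
    rw [hx', Finset.sum_apply]
    exact Finset.sum_congr rfl fun α _ => hx α
  filter_upwards [hlim, hpart] with x h1 h2
  simp_rw [h2] at h1
  rw [tendsto_nhds_unique h1 ((hsum x).hasSum.comp hns)]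
  exact (hsum x).hasSum

/-- Pairing with the regularized distribution, in terms of chaos coefficients. -/
lemma hasSum_regCoeff_mul_chaosCoeff {d : ℕ} {ε : ℝ} (hε : 0 < ε) (φ : HidaTest d) :
    Integrable (fun x => regularized d ε x * φ.toL2 x) (gaussian d) ∧
    HasSum (fun α => regCoeff ε α * chaosCoeff α φ.toL2)
      (∫ x, regularized d ε x * φ.toL2 x ∂(gaussian d)) := by
  -- With `δ = ε/4` the kernel growth `(1 - ε)/2` becomes `1/2 - ε/4`, still below the threshold
  -- `1/2` for Gaussian integrability.
  obtain ⟨R, hR, hH⟩ := exists_abs_He_le (show 0 < ε / 4 by positivity)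
  have hR0 : 0 ≤ R := by linarith
  have hs := summable_norm_chaosCoeff_mul φ R hR0
  let G : Vec d → ℝ := fun x => ‖regularized d ε x‖ * ∏ i, Real.exp (ε / 4 * x i ^ 2)
  have hG0 (x : Vec d) : 0 ≤ G x := by positivity
  have hG : Integrable G (gaussian d) := by
    have h := (Integrable.fintype_prod (μ := fun _ : Idx d => gaussianReal 0 1)
      (f := fun _ t => Real.exp ((1 / 2 - ε / 4) * t ^ 2))
      fun _ => integrable_gaussianReal_exp (by linarith)).const_mul ((2 * Real.pi) ^ d)
    refine h.congr (Eventually.of_forall fun x => ?_)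
    simp only [G]
    rw [norm_regularized, mul_assoc, ← Finset.prod_mul_distrib]
    congr 1
    refine Finset.prod_congr rfl fun i _ => ?_
    rw [← Real.exp_add]
    ring_nf
  have hbound (α : Idx d → ℕ) (x : Vec d) :
      ‖regularized d ε x * (chaosCoeff α φ.toL2 * hermiteFun α x)‖ ≤
        ‖chaosCoeff α φ.toL2‖ * R ^ degree α * G x := by
    rw [norm_mul, norm_mul]
    calc _ ≤ ‖regularized d ε x‖ * (‖chaosCoeff α φ.toL2‖ *
          (R ^ degree α * ∏ i, Real.exp (ε / 4 * x i ^ 2))) := by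
          gcongr
          exact norm_hermiteFun_le hH α x
      _ = _ := by simp only [G]; ring
  have hlim : ∀ᵐ x ∂(gaussian d), HasSum
      (fun α => regularized d ε x * (chaosCoeff α φ.toL2 * hermiteFun α x))
      (regularized d ε x * φ.toL2 x) := by
    filter_upwards [ae_hasSum_hermiteFun φ] with x hx using hx.mul_left _
  constructor
  · refine (hG.const_mul (∑' α, ‖chaosCoeff α φ.toL2‖ * R ^ degree α)).mono'
      ((continuous_regularized d ε).aestronglyMeasurable.mul (Lp.aestronglyMeasurable _)) ?_
    filter_upwards [hlim] with x hx
    rw [← hx.tsum_eq, ← tsum_mul_right]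
    exact tsum_of_norm_bounded (hs.mul_right (G x)).hasSum fun α => hbound α x
  · have h := hasSum_integral_of_dominated_convergence (μ := gaussian d)
      (F := fun α x => regularized d ε x * (chaosCoeff α φ.toL2 * hermiteFun α x))
      (f := fun x => regularized d ε x * φ.toL2 x)
      (fun α x => ‖chaosCoeff α φ.toL2‖ * R ^ degree α * G x)
      (fun α => (continuous_regularized d ε).aestronglyMeasurable.mul
        ((memLp_hermiteFun α).1.const_mul _))
      (fun α => Eventually.of_forall (hbound α))
      (Eventually.of_forall fun x => hs.mul_right (G x))
      (by simp_rw [tsum_mul_right]; exact hG.const_mul _) hlim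
    refine h.congr_fun fun α => ?_
    rw [← integral_regularized_mul_hermiteFun, mul_comm, ← integral_const_mul]
    congr 1
    funext x
    ring

/-! ### Distributions from weighted `ℓ²` sequences -/

/-- The weighted chaos coefficients as a continuous map `(M) → ℓ²`. -/
def weightedCoeffCLM (d q : ℕ) : HidaTest d →L[ℂ] lp (fun _ : Idx d → ℕ => ℂ) 2 where
  toLinearMap := weightedCoeff d q
  cont := by
    refine WithSeminorms.continuous_normedSpace_rng _ (withSeminorms_hida d)
      (weightedCoeff d q) ⟨{q}, 1, ?_⟩
    rw [Finset.sup_singleton, one_smul]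
    exact le_rfl

/-- The Hida distribution with weighted chaos coefficients `v ∈ ℓ²`. -/
def ofWeighted (d q : ℕ) (v : lp (fun _ : Idx d → ℕ => ℂ) 2) : HidaDistribution d :=
  ContinuousLinearMap.precomp ℂ (weightedCoeffCLM d q) (innerSL ℂ v)

/-- Precomposition with a continuous linear map is continuous for uniform convergence on bounded
sets. This turns `ℓ²` convergence into strong convergence in `(M)'`. -/
lemma continuous_ofWeighted (d q : ℕ) : Continuous (ofWeighted d q) :=
  (ContinuousLinearMap.continuous _).comp (innerSL ℂ).continuous

lemma norm_conj_div_sq {a : ℂ} {n : ℕ} :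
    ‖(starRingEnd ℂ) a / ((√2 ^ (3 * n) : ℝ) : ℂ)‖ ^ 2 = ‖a‖ ^ 2 / 8 ^ n := by
  have h8 : (√2 ^ (3 * n)) ^ 2 = (8 : ℝ) ^ n := by
    rw [← pow_mul, mul_comm, pow_mul, Real.sq_sqrt (by norm_num), pow_mul]
    norm_num
  rw [norm_div, RCLike.norm_conj, Complex.norm_real, Real.norm_of_nonneg (by positivity), div_pow,
    h8]

lemma sq_div_eight_le {a : ℂ} {C : ℝ} {n : ℕ} (h : ‖a‖ ≤ C * 2 ^ n) :
    ‖a‖ ^ 2 / 8 ^ n ≤ C ^ 2 * (1 / 2) ^ n := by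
  calc ‖a‖ ^ 2 / 8 ^ n ≤ (C * 2 ^ n) ^ 2 / 8 ^ n := by gcongr
    _ = C ^ 2 * (4 / 8) ^ n := by
      rw [mul_pow, ← pow_mul, mul_comm n, pow_mul, div_pow, mul_div_assoc]; norm_num
    _ = _ := by norm_num

/-- Coefficients growing at most like `2 ^ |α|`, weighted so as to lie in `ℓ²`. -/
def weightedVec {d : ℕ} (A : (Idx d → ℕ) → ℂ) (C : ℝ) (hA : ∀ α, ‖A α‖ ≤ C * 2 ^ degree α) :
    lp (fun _ : Idx d → ℕ => ℂ) 2 :=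
  -- The conjugate compensates for the antilinear first slot of the inner product. The weight index
  -- 3 is the least natural number making `4^|α| / 2^(q|α|)` decay geometrically.
  ⟨fun α => (starRingEnd ℂ) (A α) / ((√2 ^ (3 * degree α) : ℝ) : ℂ), by
    refine memℓp_gen ?_
    refine Summable.of_nonneg_of_le (fun α => by positivity) (fun α => ?_)
      ((summable_pow_degree (d := d) (ρ := 1 / 2) (by norm_num) (by norm_num)).mul_left (C ^ 2))
    simp only [ENNReal.toReal_ofNat, Real.rpow_ofNat]
    rw [norm_conj_div_sq]
    exact sq_div_eight_le (hA α)⟩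

lemma ofWeighted_weightedVec_apply {d : ℕ} (A : (Idx d → ℕ) → ℂ) (C : ℝ)
    (hA : ∀ α, ‖A α‖ ≤ C * 2 ^ degree α) (φ : HidaTest d) :
    HasSum (fun α => A α * chaosCoeff α φ.toL2) (ofWeighted d 3 (weightedVec A C hA) φ) := by
  have h := lp.hasSum_inner (𝕜 := ℂ) (weightedVec A C hA) (weightedCoeff d 3 φ)
  refine h.congr_fun fun α => ?_
  have h2 : ((√2 ^ (3 * degree α) : ℝ) : ℂ) ≠ 0 := by
    have : (0 : ℝ) < √2 ^ (3 * degree α) := by positivity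
    exact_mod_cast this.ne'
  simp only [weightedVec, weightedCoeff, LinearMap.coe_mk, AddHom.coe_mk, RCLike.inner_apply,
    map_div₀, Complex.conj_conj, Complex.conj_ofReal]
  field_simp

/-- Dominated convergence for series: the squared distance has terms at most `(2C)² (1/2)^|α|`, each
tending to 0. -/
lemma tendsto_weightedVec {d : ℕ} {l : Filter ℝ} [l.IsCountablyGenerated]
    (A : ℝ → (Idx d → ℕ) → ℂ) (B : (Idx d → ℕ) → ℂ) (C : ℝ)
    (hA : ∀ ε α, ‖A ε α‖ ≤ C * 2 ^ degree α) (hB : ∀ α, ‖B α‖ ≤ C * 2 ^ degree α)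
    (hlim : ∀ α, Tendsto (fun ε => A ε α) l (𝓝 (B α))) :
    Tendsto (fun ε => weightedVec (A ε) C (hA ε)) l (𝓝 (weightedVec B C hB)) := by
  have hn (ε : ℝ) : ‖weightedVec (A ε) C (hA ε) - weightedVec B C hB‖ ^ 2 =
      ∑' α, ‖A ε α - B α‖ ^ 2 / 8 ^ degree α := by
    have h := lp.norm_rpow_eq_tsum (p := 2) (by simp)
      (weightedVec (A ε) C (hA ε) - weightedVec B C hB)
    simp only [ENNReal.toReal_ofNat, Real.rpow_ofNat] at h
    refine h.trans (tsum_congr fun α => ?_)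
    rw [← norm_conj_div_sq, map_sub, sub_div]
    rfl
  have h0 : Tendsto (fun ε => ∑' α, ‖A ε α - B α‖ ^ 2 / 8 ^ degree α) l
      (𝓝 (∑' _ : Idx d → ℕ, (0 : ℝ))) := by
    refine tendsto_tsum_of_dominated_convergence
      (bound := fun α => (2 * C) ^ 2 * (1 / 2) ^ degree α)
      ((summable_pow_degree (by norm_num) (by norm_num)).mul_left _) (fun α => ?_)
      (Eventually.of_forall fun ε α => ?_)
    · have h := (((hlim α).sub_const (B α)).norm.pow 2).div_const (8 ^ degree α)
      simpa using h
    · rw [Real.norm_of_nonneg (by positivity)]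
      refine sq_div_eight_le ((norm_sub_le _ _).trans ?_)
      linarith [hA ε α, hB α]
  rw [tsum_zero] at h0
  rw [tendsto_iff_norm_sub_tendsto_zero]
  have h1 := h0.sqrt
  rw [Real.sqrt_zero] at h1
  refine h1.congr fun ε => ?_
  rw [← hn, Real.sqrt_sq (norm_nonneg _)]

/-- The plane wave `exp (i ⟨·, F⟩)` as a test function. -/
def waveTest {d : ℕ} (F : Vec d) : HidaTest d :=
  ⟨waveLp F, fun q => (hasSum_norm_sq_chaosCoeff_waveLp q F).summable⟩

lemma waveTest_toL2 {d : ℕ} (F : Vec d) : (waveTest F).toL2 =ᵐ[gaussian d]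
    fun x => Complex.exp (Complex.I * ((x ⬝ᵥ F : ℝ) : ℂ)) :=
  (memLp_charFun F).coeFn_toLp

end SymplecticFeynman

end

/-! ### The limit distribution and its `T`-transform -/

theorem proposition3p2 (d : ℕ) :
    ∃ Φε : ℝ → SymplecticFeynman.HidaDistribution d,
      (∀ ε : ℝ, 0 < ε →
        SymplecticFeynman.IsGivenBy (Φε ε) (SymplecticFeynman.regularized d ε)) ∧
      ∃ Φ : SymplecticFeynman.HidaDistribution d,
        Tendsto Φε (𝓝[>] 0) (𝓝 Φ) ∧
        SymplecticFeynman.IsTTransform Φ (fun F : SymplecticFeynman.Vec d =>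
          (2 * (Real.pi : ℂ)) ^ d *
            Complex.exp (-Complex.I *
              ∑ μ : Fin d, (F (Sum.inl μ) : ℂ) * (F (Sum.inr μ) : ℂ))) := by
  open SymplecticFeynman in
  choose B hBlim using exists_tendsto_regCoeff (d := d)
  have hpos : ∀ᶠ ε : ℝ in 𝓝[>] 0, 0 < ε := self_mem_nhdsWithin
  have hB (α) : ‖B α‖ ≤ (2 * Real.pi) ^ d * 2 ^ degree α :=
    le_of_tendsto (hBlim α).norm (hpos.mono fun ε hε => norm_regCoeff_le hε α)
  -- The family is indexed by all real `ε`; the limit coefficients `B` serve as values for `ε ≤ 0`,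
  -- so that the uniform bound holds everywhere.
  let A : ℝ → (Idx d → ℕ) → ℂ := fun ε => if 0 < ε then regCoeff ε else B
  have hApos {ε : ℝ} (hε : 0 < ε) : A ε = regCoeff ε := if_pos hε
  have hA (ε α) : ‖A ε α‖ ≤ (2 * Real.pi) ^ d * 2 ^ degree α := by
    by_cases hε : 0 < ε
    · rw [hApos hε]
      exact norm_regCoeff_le hε α
    · simp only [A, if_neg hε]
      exact hB α
  have hAlim (α) : Tendsto (fun ε => A ε α) (𝓝[>] 0) (𝓝 (B α)) :=
    (hBlim α).congr' (hpos.mono fun ε hε => (congrFun (hApos hε) α).symm)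
  have hgiven : ∀ ε : ℝ, 0 < ε →
      IsGivenBy (ofWeighted d 3 (weightedVec (A ε) _ (hA ε))) (regularized d ε) := by
    intro ε hε φ
    obtain ⟨h1, h2⟩ := hasSum_regCoeff_mul_chaosCoeff hε φ
    refine ⟨h1, (ofWeighted_weightedVec_apply _ _ (hA ε) φ).unique ?_⟩
    rw [hApos hε]
    exact h2
  have hlim := ((continuous_ofWeighted d 3).tendsto _).comp
    (tendsto_weightedVec A B _ hA hB hAlim)
  refine ⟨_, hgiven, _, hlim, fun F => ⟨waveTest F, waveTest_toL2 F, ?_⟩⟩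
  -- Strong convergence implies convergence on each plane wave, so uniqueness of limits identifies
  -- the `T`-transform without knowing `B`.
  have h1 := ((continuous_eval_const (F := HidaDistribution d) (waveTest F)).tendsto _).comp hlim
  refine tendsto_nhds_unique h1
    ((tendsto_integral_regularized_mul_wave F).congr' (hpos.mono fun ε hε => ?_))
  refine Eq.trans ?_ (hgiven ε hε (waveTest F)).2.symm
  refine integral_congr_ae ?_
  filter_upwards [waveTest_toL2 F] with x hx
  rw [hx]
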